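/- Let $L,a,b,c,M,N>0$ and $p\in L^1[0,L]$, and consider the boundary value problem $$w''''-\Big(a+b\int_0^L w\Big)w''+c\int_0^L w=p(x)\ \text{ for a.e. }x\in(0,L),\qquad w(0)=w(L)=w''(0)=w''(L)=0, \tag{P}$$ with solutions in $W^{4,1}[0,L]$. A lower (upper) solution is a function in $W^{4,1}[0,L]$ that satisfies the same boundary conditions and the differential equation with $=$ replaced by $\le$ ($\ge$). For functions $u,v\in C^2[0,L]$ write $u\preceq v$ if $u\le v$ and $u''\ge v''$ on $[0,L]$, let $[\alpha,\beta]=\{u\in C^2[0,L]:\alpha\preceq u\preceq\beta\}$, and let $\|\cdot\|_\infty$ be the supremum norm on $[0,L]$. Assume that $$N\le\frac{4M}{L^3}\,\sigma(\sqrt M L),\qquad \sigma(t)=\frac{3t^3}{6t\cosh t+6t-12\sinh t-t^3},$$ that $\alpha$ is a lower solution and $\beta$ an upper solution of (P) with $0\le\alpha\le\beta$ and $0\ge\alpha''\ge\beta''$ on $[0,L]$, that $$a+b\int_0^L\beta\le M,\qquad c-b\min_{[0,L]}\beta''\le N,$$ and that $$a+b\int_0^L\alpha+\frac{L^3}{4}c>\frac{L^3N}{4}+M-\frac{4}{L^2}.$$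 Put $$\rho=\frac{L\tanh(\sqrt M L/2)}{2\sqrt M}\Big[M-\Big(a+b\int_0^L\alpha\Big)+\frac{L^3}{4}\Big(N-c+b\max_{[0,L]}\alpha''\Big)\Big].$$ Let $(\alpha_n)_{n\ge0}$ and $(\beta_n)_{n\ge0}$ be the sequences with $\alpha_0=\alpha$, $\beta_0=\beta$ whose further terms $y_n\in W^{4,1}[0,L]$, $n\ge1$, are the solutions of the linear problems $$y_n''''-My_n''+N\int_0^L y_n=p+ay_{n-1}''+by_{n-1}''\int_0^L y_{n-1}-c\int_0^L y_{n-1}-My_{n-1}''+N\int_0^L y_{n-1}\ \text{ a.e. on }(0,L),$$ $$y_n(0)=y_n(L)=y_n''(0)=y_n''(L)=0 .$$ Then $0\le\rho<1$, these sequences exist, problem (P) has exactly one solution $\widetilde y$ in $[\alpha,\beta]$, the sequences are monotone, $\alpha_n\preceq\alpha_{n+1}$, $\beta_{n+1}\preceq\beta_n$ and $\alpha_n\preceq\beta_n$ for all $n\ge0$, and both converge to $\widetilde y$ uniformly on $[0,L]$. Moreover, for $(y_n)=(\alpha_n)$ and for $(y_n)=(\beta_n)$ and all $n\ge0$, $$\|y_{n+1}-y_n\|_\infty\le\frac{L^2}{4}\|y_{n+1}''-y_n''\|_\infty\le\frac{L^2}{4}\rho^n\|y_1''-y_0''\|_\infty\le\frac{L^2}{4}\rho^n\|\alpha''-\beta''\|_\infty,$$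 $$\|y_n-\widetilde y\|_\infty\le\frac{L^2}{4}\|y_n''-\widetilde y''\|_\infty\le\frac{L^2}{4}\,\frac{\rho^n}{1-\rho}\,\|\alpha''-\beta''\|_\infty,$$ and the right-hand sides tend to $0$ as $n\to\infty$. -/

import Mathlib

open Set MeasureTheory Filter Topology

noncomputable section

namespace Melan

/-- The `k`-th derivative of a function on `[0, L]` (one-sided at the end points); it depends only
on the values of `y` on `[0, L]`. -/
def D (L : ℝ) (k : ℕ) (y : ℝ → ℝ) : ℝ → ℝ :=
  iteratedDerivWithin k y (Icc 0 L)

/-- `y ∈ W^{4,1}[0, L]` (for the continuous representative): `y` is `C³` on `[0, L]` and `y'''` is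
absolutely continuous on `[0, L]`. The fourth derivative `D L 4 y` then exists almost everywhere. -/
def MemW41 (L : ℝ) (y : ℝ → ℝ) : Prop :=
  ContDiffOn ℝ 3 y (Icc 0 L) ∧ AbsolutelyContinuousOnInterval (D L 3 y) 0 L

/-- Boundary conditions `y(0) = y(L) = y''(0) = y''(L) = 0`. -/
def NavierBC (L : ℝ) (y : ℝ → ℝ) : Prop :=
  y 0 = 0 ∧ y L = 0 ∧ D L 2 y 0 = 0 ∧ D L 2 y L = 0

/-- The norm `‖g‖_∞ = sup_{x ∈ [0, L]} |g x|` of a bounded function on `[0, L]`. -/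
def supNorm (L : ℝ) (g : ℝ → ℝ) : ℝ :=
  sSup ((fun x => |g x|) '' Icc 0 L)

/-- The nonlinear nonlocal expression
`w'''' - (a + b ∫₀ᴸ w) w'' + c ∫₀ᴸ w`. -/
def melanOp (L a b c : ℝ) (w : ℝ → ℝ) (x : ℝ) : ℝ :=
  D L 4 w x - (a + b * ∫ t in (0 : ℝ)..L, w t) * D L 2 w x + c * ∫ t in (0 : ℝ)..L, w t

/-- The linear operator `G w = w'''' - M w'' + N ∫₀ᴸ w`. -/
def linOp (L M N : ℝ) (w : ℝ → ℝ) (x : ℝ) : ℝ :=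
  D L 4 w x - M * D L 2 w x + N * ∫ t in (0 : ℝ)..L, w t

/-- `f(x, ∫₀ᴸ y, y''(x)) = p(x) + a y''(x) + b y''(x) ∫₀ᴸ y - c ∫₀ᴸ y`. -/
def rhs (L a b c : ℝ) (p y : ℝ → ℝ) (x : ℝ) : ℝ :=
  p x + a * D L 2 y x + b * D L 2 y x * (∫ t in (0 : ℝ)..L, y t) - c * ∫ t in (0 : ℝ)..L, y t

/-- Solutions in `W^{4,1}[0, L]` of the boundary value problem. -/
def IsSolution (L a b c : ℝ) (p y : ℝ → ℝ) : Prop :=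
  MemW41 L y ∧ (∀ᵐ x ∂volume.restrict (Ioo 0 L), melanOp L a b c y x = p x) ∧ NavierBC L y

def IsLowerSolution (L a b c : ℝ) (p y : ℝ → ℝ) : Prop :=
  MemW41 L y ∧ (∀ᵐ x ∂volume.restrict (Ioo 0 L), melanOp L a b c y x ≤ p x) ∧ NavierBC L y

def IsUpperSolution (L a b c : ℝ) (p y : ℝ → ℝ) : Prop :=
  MemW41 L y ∧ (∀ᵐ x ∂volume.restrict (Ioo 0 L), p x ≤ melanOp L a b c y x) ∧ NavierBC L y

/-- `u ≤ v` and `u'' ≥ v''` on `[0, L]`. -/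
def Below (L : ℝ) (u v : ℝ → ℝ) : Prop :=
  ∀ x ∈ Icc (0 : ℝ) L, u x ≤ v x ∧ D L 2 v x ≤ D L 2 u x

/-- The sector `[α, β] = {u ∈ C²[0, L] | α ≤ u ≤ β, α'' ≥ u'' ≥ β''}`. -/
def sector (L : ℝ) (α β : ℝ → ℝ) : Set (ℝ → ℝ) :=
  {u | ContDiffOn ℝ 2 u (Icc 0 L) ∧ Below L α u ∧ Below L u β}

/-- `Y` is a sequence produced by the iterative procedure
`G yₙ = f(x, ∫₀ᴸ yₙ₋₁, yₙ₋₁'') - M yₙ₋₁'' + N ∫₀ᴸ yₙ₋₁` with the Navier boundary conditions,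
started at `y₀`. -/
def IsIteration (L a b c M N : ℝ) (p y₀ : ℝ → ℝ) (Y : ℕ → ℝ → ℝ) : Prop :=
  Y 0 = y₀ ∧ ∀ n, MemW41 L (Y (n + 1)) ∧
    (∀ᵐ x ∂volume.restrict (Ioo 0 L), linOp L M N (Y (n + 1)) x =
      rhs L a b c p (Y n) x - M * D L 2 (Y n) x + N * ∫ t in (0 : ℝ)..L, Y n t) ∧
    NavierBC L (Y (n + 1))

/-- `σ(t) = 3t³ / (6 t cosh t + 6 t - 12 sinh t - t³)`. -/
def sigma (t : ℝ) : ℝ :=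
  3 * t ^ 3 / (6 * t * Real.cosh t + 6 * t - 12 * Real.sinh t - t ^ 3)

/-- The contraction rate
`ρ = L tanh(√M L / 2) / (2√M) · [M - (a + b ∫₀ᴸ α) + L³/4 (N - c + b max α'')]`. -/
def rho (L a b c M N : ℝ) (α : ℝ → ℝ) : ℝ :=
  L * (Real.tanh (√M * L / 2) / (2 * √M)) *
    (M - (a + b * ∫ t in (0 : ℝ)..L, α t)
      + L ^ 3 / 4 * (N - c + b * sSup (D L 2 α '' Icc 0 L)))

end Melan

end


/-!
In terms of `u = -y''` the fourth-order problem becomes a second-order one: since `y` and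
`bump L` (the solution of `-e'' = 1`) vanish at the end points, `∫ y = ∫ bump L * u`. The linear
problem is then `-u'' + m² u + N ∫ bump L * u = h`, and eliminating the nonlocal term shows that
its kernel is, up to a positive factor, `(1 + N κ) g - N τ ⊗ q`, where `g` is the Green kernel
of `-u'' + m² u`, `τ` and `q` are the solutions of that equation with right-hand sides `1` and
`bump L`, and `κ = ∫ bump L * τ`. Both factors of the product are dominated by `sinh` near the end
points, and the condition `N ≤ 4M σ(√M L) / L³` is what makes the kernel nonnegative. Hence the
linear problem is order preserving, and `τ` bounds its solution operator. On the functions between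
`-α''` and `-β''` the nonlinear right-hand side is increasing and Lipschitz in `u`, so that the
iteration is monotone and a contraction with factor `ρ`.
-/

namespace Melan

theorem absolutelyContinuousOnInterval_congr {a b : ℝ} {f g : ℝ → ℝ}
    (hf : AbsolutelyContinuousOnInterval f a b) (h : EqOn f g (uIcc a b)) :
    AbsolutelyContinuousOnInterval g a b := by
  rw [absolutelyContinuousOnInterval_iff] at hf ⊢
  intro ε hε
  obtain ⟨δ, hδ, H⟩ := hf ε hε
  refine ⟨δ, hδ, fun E hE hl => ?_⟩
  refine (Finset.sum_congr rfl fun i hi => ?_).trans_lt (H E hE hl)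
  rw [h (hE.1 i hi).1, h (hE.1 i hi).2]

/-- `f` is absolutely continuous on `[a, b]`, with derivative `f'` almost everywhere. -/
structure IsPrimitive (a b : ℝ) (f f' : ℝ → ℝ) : Prop where
  absolutelyContinuous : AbsolutelyContinuousOnInterval f a b
  ae_hasDerivAt : ∀ᵐ x ∂volume.restrict (Ioo a b), HasDerivAt f (f' x) x

namespace IsPrimitive

variable {a b k : ℝ} {f f' g g' : ℝ → ℝ}

theorem add (hf : IsPrimitive a b f f') (hg : IsPrimitive a b g g') :
    IsPrimitive a b (fun x => f x + g x) (fun x => f' x + g' x) where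
  absolutelyContinuous := hf.1.fun_add hg.1
  ae_hasDerivAt := by filter_upwards [hf.2, hg.2] with x h₁ h₂ using h₁.add h₂

theorem sub (hf : IsPrimitive a b f f') (hg : IsPrimitive a b g g') :
    IsPrimitive a b (fun x => f x - g x) (fun x => f' x - g' x) where
  absolutelyContinuous := hf.1.fun_sub hg.1
  ae_hasDerivAt := by filter_upwards [hf.2, hg.2] with x h₁ h₂ using h₁.sub h₂

theorem neg (hf : IsPrimitive a b f f') : IsPrimitive a b (fun x => -f x) (fun x => -f' x) where
  absolutelyContinuous := hf.1.fun_neg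
  ae_hasDerivAt := by filter_upwards [hf.2] with x h using h.neg

theorem const_mul (k : ℝ) (hf : IsPrimitive a b f f') :
    IsPrimitive a b (fun x => k * f x) (fun x => k * f' x) where
  absolutelyContinuous := hf.1.const_mul k
  ae_hasDerivAt := by filter_upwards [hf.2] with x h using h.const_mul k

theorem mul (hf : IsPrimitive a b f f') (hg : IsPrimitive a b g g') :
    IsPrimitive a b (fun x => f x * g x) (fun x => f' x * g x + f x * g' x) where
  absolutelyContinuous := hf.1.fun_mul hg.1
  ae_hasDerivAt := by filter_upwards [hf.2, hg.2] with x h₁ h₂ using h₁.mul h₂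

theorem congr (hab : a ≤ b) (hf : IsPrimitive a b f f') (h : EqOn f g (Icc a b))
    (h' : ∀ᵐ x ∂volume.restrict (Ioo a b), f' x = g' x) : IsPrimitive a b g g' where
  absolutelyContinuous := absolutelyContinuousOnInterval_congr hf.1 (by rwa [uIcc_of_le hab])
  ae_hasDerivAt := by
    filter_upwards [hf.2, h', ae_restrict_mem measurableSet_Ioo] with x hfx hx hmem
    have hgf : g =ᶠ[𝓝 x] f := by
      filter_upwards [Icc_mem_nhds hmem.1 hmem.2] with t ht using (h ht).symm
    exact (hx ▸ hfx).congr_of_eventuallyEq hgf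

theorem congr_ae (hf : IsPrimitive a b f f')
    (h : ∀ᵐ x ∂volume.restrict (Ioo a b), f' x = g' x) : IsPrimitive a b f g' :=
  ⟨hf.1, by filter_upwards [hf.2, h] with x hfx hx using hx ▸ hfx⟩

theorem mono {c d : ℝ} (hf : IsPrimitive a b f f') (hac : a ≤ c) (hcd : c ≤ d) (hdb : d ≤ b) :
    IsPrimitive c d f f' where
  absolutelyContinuous := hf.1.mono <| by
    rw [uIcc_of_le hcd, uIcc_of_le (hac.trans (hcd.trans hdb))]
    exact Icc_subset_Icc hac hdb
  ae_hasDerivAt := ae_restrict_of_ae_restrict_of_subset (Ioo_subset_Ioo hac hdb) hf.2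

theorem of_hasDerivAt (h : ∀ x, HasDerivAt f (f' x) x) (hf' : Continuous f') :
    IsPrimitive a b f f' where
  absolutelyContinuous := by
    have hC1 : ContDiff ℝ 1 f := contDiff_one_iff_deriv.2
      ⟨fun x => (h x).differentiableAt, by rwa [show deriv f = f' from funext fun x => (h x).deriv]⟩
    exact hC1.contDiffOn.absolutelyContinuousOnInterval
  ae_hasDerivAt := .of_forall h

theorem integral (hab : a ≤ b) (hf : IntervalIntegrable f volume a b) :
    IsPrimitive a b (fun x => ∫ t in a..x, f t) f where
  absolutelyContinuous := hf.absolutelyContinuousOnInterval_intervalIntegral left_mem_uIcc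
  ae_hasDerivAt := by
    filter_upwards [ae_restrict_of_ae hf.ae_hasDerivAt_integral, ae_restrict_mem measurableSet_Ioo]
      with x hx hmem
    exact hx (by rw [uIcc_of_le hab]; exact Ioo_subset_Icc_self hmem) a left_mem_uIcc

theorem continuousOn (hab : a ≤ b) (hf : IsPrimitive a b f f') : ContinuousOn f (Icc a b) := by
  simpa only [uIcc_of_le hab] using hf.1.continuousOn

theorem intervalIntegrable_deriv (hab : a ≤ b) (hf : IsPrimitive a b f f') :
    IntervalIntegrable f' volume a b := by
  refine hf.1.intervalIntegrable_deriv.congr_ae ?_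
  rw [uIoc_of_le hab, ← restrict_Ioo_eq_restrict_Ioc]
  filter_upwards [hf.2] with x hx using hx.deriv

theorem intervalIntegrable (hab : a ≤ b) (hf : IsPrimitive a b f f') :
    IntervalIntegrable f volume a b :=
  (hf.continuousOn hab).intervalIntegrable_of_Icc hab

theorem integral_eq_sub (hab : a ≤ b) (hf : IsPrimitive a b f f') :
    ∫ x in a..b, f' x = f b - f a := by
  rw [← hf.1.integral_deriv_eq_sub]
  refine intervalIntegral.integral_congr_ae_restrict ?_
  rw [uIoc_of_le hab, ← restrict_Ioo_eq_restrict_Ioc]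
  filter_upwards [hf.2] with x hx using hx.deriv.symm

theorem ae_eq (hf : IsPrimitive a b f f') (hg : IsPrimitive a b f g') :
    ∀ᵐ x ∂volume.restrict (Ioo a b), f' x = g' x := by
  filter_upwards [hf.2, hg.2] with x h₁ h₂ using h₁.unique h₂

theorem hasDerivWithinAt (hf : IsPrimitive a b f f') (hf' : ContinuousOn f' (Icc a b)) {x : ℝ}
    (hx : x ∈ Icc a b) : HasDerivWithinAt f (f' x) (Icc a b) x := by
  have : Fact (x ∈ Icc a b) := ⟨hx⟩
  have hint : IntervalIntegrable f' volume a x :=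
    (hf.mono le_rfl hx.1 hx.2).intervalIntegrable_deriv hx.1
  have hFTC : HasDerivWithinAt (fun u => ∫ t in a..u, f' t) (f' x) (Icc a b) x :=
    intervalIntegral.integral_hasDerivWithinAt_right hint
      (hf'.stronglyMeasurableAtFilter_nhdsWithin measurableSet_Icc x) (hf' x hx)
  have hfeq : ∀ t ∈ Icc a b, f t = f a + ∫ s in a..t, f' s := fun t ht => by
    rw [(hf.mono le_rfl ht.1 ht.2).integral_eq_sub ht.1, add_sub_cancel]
  exact (hFTC.const_add (f a)).congr hfeq (hfeq x hx)

theorem derivWithin_eqOn (hab : a < b) (hf : IsPrimitive a b f f')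
    (hf' : ContinuousOn f' (Icc a b)) : EqOn (derivWithin f (Icc a b)) f' (Icc a b) := fun x hx =>
  (hf.hasDerivWithinAt hf' hx).derivWithin (uniqueDiffOn_Icc hab x hx)

theorem contDiffOn_succ {n : ℕ} (hab : a < b) (hf : IsPrimitive a b f f')
    (hf' : ContDiffOn ℝ n f' (Icc a b)) : ContDiffOn ℝ (n + 1) f (Icc a b) := by
  rw [contDiffOn_succ_iff_derivWithin (uniqueDiffOn_Icc hab)]
  exact ⟨fun x hx => (hf.hasDerivWithinAt hf'.continuousOn hx).differentiableWithinAt, by simp,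
    hf'.congr (hf.derivWithin_eqOn hab hf'.continuousOn)⟩

end IsPrimitive

section Derivatives

variable {L : ℝ} {k n : ℕ} {y z : ℝ → ℝ}

theorem D_zero : D L 0 y = y := iteratedDerivWithin_zero

theorem D_succ : D L (k + 1) y = derivWithin (D L k y) (Icc 0 L) := iteratedDerivWithin_succ

theorem continuousOn_D (hL : 0 < L) (hk : k ≤ n) (hy : ContDiffOn ℝ n y (Icc 0 L)) :
    ContinuousOn (D L k y) (Icc 0 L) :=
  hy.continuousOn_iteratedDerivWithin (mod_cast hk) (uniqueDiffOn_Icc hL)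

theorem isPrimitive_D (hL : 0 ≤ L) (hy : AbsolutelyContinuousOnInterval (D L k y) 0 L) :
    IsPrimitive 0 L (D L k y) (D L (k + 1) y) where
  absolutelyContinuous := hy
  ae_hasDerivAt := by
    filter_upwards [ae_restrict_of_ae hy.ae_differentiableAt, ae_restrict_mem measurableSet_Ioo]
      with x hdiff hx
    rw [D_succ, derivWithin_of_mem_nhds (Icc_mem_nhds hx.1 hx.2)]
    exact (hdiff (by rw [uIcc_of_le hL]; exact Ioo_subset_Icc_self hx)).hasDerivAt

theorem isPrimitive_D_of_contDiffOn (hL : 0 < L) (hk : k < n) (hy : ContDiffOn ℝ n y (Icc 0 L)) :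
    IsPrimitive 0 L (D L k y) (D L (k + 1) y) := by
  have hu := uniqueDiffOn_Icc hL
  have hC1 : ContDiffOn ℝ 1 (D L k y) (Icc 0 L) := by
    rw [← zero_add (1 : WithTop ℕ∞), contDiffOn_succ_iff_derivWithin hu, ← D_succ, contDiffOn_zero]
    exact ⟨hy.differentiableOn_iteratedDerivWithin (mod_cast hk) hu, by simp,
      continuousOn_D hL hk hy⟩
  exact isPrimitive_D hL.le (uIcc_of_le hL.le ▸ hC1).absolutelyContinuousOnInterval

theorem IsPrimitive.D_succ_eqOn (hL : 0 < L) (hy : IsPrimitive 0 L y z)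
    (hz : ContinuousOn z (Icc 0 L)) : EqOn (D L (k + 1) y) (D L k z) (Icc 0 L) := by
  rw [D, iteratedDerivWithin_succ']
  exact iteratedDerivWithin_congr (hy.derivWithin_eqOn hL hz)

theorem memW41_of_isPrimitive (hL : 0 < L) {y₁ y₂ y₃ y₄ : ℝ → ℝ} (h₀ : IsPrimitive 0 L y y₁)
    (h₁ : IsPrimitive 0 L y₁ y₂) (h₂ : IsPrimitive 0 L y₂ y₃) (h₃ : IsPrimitive 0 L y₃ y₄) :
    MemW41 L y ∧ EqOn (D L 2 y) y₂ (Icc 0 L) ∧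
      ∀ᵐ x ∂volume.restrict (Ioo 0 L), D L 4 y x = y₄ x := by
  have c₁ := h₁.continuousOn hL.le
  have c₂ := h₂.continuousOn hL.le
  have c₃ := h₃.continuousOn hL.le
  have hC3 : ContDiffOn ℝ 3 y (Icc 0 L) := by
    have hC1 := h₂.contDiffOn_succ (n := 0) hL (contDiffOn_zero.2 c₃)
    have hC2 := h₁.contDiffOn_succ (n := 1) hL (by simpa using hC1)
    exact h₀.contDiffOn_succ (n := 2) hL (by simpa [one_add_one_eq_two] using hC2)
  have e₂ : EqOn (D L 2 y) y₂ (Icc 0 L) := (h₀.D_succ_eqOn hL c₁).trans (h₁.D_succ_eqOn hL c₂)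
  have e₃ : EqOn (D L 3 y) y₃ (Icc 0 L) :=
    (h₀.D_succ_eqOn hL c₁).trans ((h₁.D_succ_eqOn hL c₂).trans (h₂.D_succ_eqOn hL c₃))
  have hprim : IsPrimitive 0 L (D L 3 y) y₄ := h₃.congr hL.le e₃.symm (.of_forall fun _ => rfl)
  exact ⟨⟨hC3, hprim.1⟩, e₂, (isPrimitive_D hL.le hprim.1).ae_eq hprim⟩

end Derivatives

/-- `u ∈ W^{2,1}[0, L]` with `u 0 = u L = 0`; the derivatives `u'` and `u''` are carried along as
data, the second one only up to null sets. -/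
structure IsDirichlet (L : ℝ) (u u' u'' : ℝ → ℝ) : Prop where
  primitive : IsPrimitive 0 L u u'
  primitive' : IsPrimitive 0 L u' u''
  left : u 0 = 0
  right : u L = 0

/-- The solution of `-e'' = 1`, `e 0 = e L = 0`. -/
noncomputable def bump (L x : ℝ) : ℝ := x * (L - x) / 2

@[fun_prop]
theorem continuous_bump (L : ℝ) : Continuous (bump L) := by unfold bump; fun_prop

theorem bump_nonneg {L x : ℝ} (hx : x ∈ Icc 0 L) : 0 ≤ bump L x :=
  div_nonneg (mul_nonneg hx.1 (sub_nonneg.2 hx.2)) zero_le_two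

theorem bump_le (L x : ℝ) : bump L x ≤ L ^ 2 / 8 := by
  rw [bump]; nlinarith [sq_nonneg (x - L / 2)]

theorem isDirichlet_bump (L : ℝ) : IsDirichlet L (bump L) (fun x => L / 2 - x) (fun _ => -1) where
  primitive := by
    refine .of_hasDerivAt (fun x => ?_) (by fun_prop)
    refine (((hasDerivAt_id x).mul ((hasDerivAt_id x).const_sub L)).div_const 2).congr_deriv ?_
    simp only [id]; ring
  primitive' := .of_hasDerivAt (fun x => (hasDerivAt_id x).const_sub _) (by fun_prop)
  left := by simp [bump]
  right := by simp [bump]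

theorem integral_bump (L : ℝ) : ∫ x in (0 : ℝ)..L, bump L x = L ^ 3 / 12 := by
  simp only [bump, intervalIntegral.integral_div, mul_sub, ← pow_two]
  rw [intervalIntegral.integral_sub (Continuous.intervalIntegrable (by fun_prop) _ _)
    (Continuous.intervalIntegrable (by fun_prop) _ _),
    intervalIntegral.integral_mul_const, integral_id, integral_pow]
  ring

namespace IsDirichlet

variable {L : ℝ} {u u' u'' v v' v'' : ℝ → ℝ}

theorem add (hu : IsDirichlet L u u' u'') (hv : IsDirichlet L v v' v'') :
    IsDirichlet L (fun x => u x + v x) (fun x => u' x + v' x) (fun x => u'' x + v'' x) :=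
  ⟨hu.1.add hv.1, hu.2.add hv.2, by simp [hu.3, hv.3], by simp [hu.4, hv.4]⟩

theorem sub (hu : IsDirichlet L u u' u'') (hv : IsDirichlet L v v' v'') :
    IsDirichlet L (fun x => u x - v x) (fun x => u' x - v' x) (fun x => u'' x - v'' x) :=
  ⟨hu.1.sub hv.1, hu.2.sub hv.2, by simp [hu.3, hv.3], by simp [hu.4, hv.4]⟩

theorem const_mul (k : ℝ) (hu : IsDirichlet L u u' u'') :
    IsDirichlet L (fun x => k * u x) (fun x => k * u' x) (fun x => k * u'' x) :=
  ⟨hu.1.const_mul k, hu.2.const_mul k, by simp [hu.3], by simp [hu.4]⟩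

theorem congr_ae (hu : IsDirichlet L u u' u'')
    (h : ∀ᵐ x ∂volume.restrict (Ioo 0 L), u'' x = v'' x) : IsDirichlet L u u' v'' :=
  ⟨hu.1, hu.2.congr_ae h, hu.3, hu.4⟩

theorem integral_mul_comm (hL : 0 ≤ L) (hu : IsDirichlet L u u' u'')
    (hv : IsDirichlet L v v' v'') :
    ∫ x in (0 : ℝ)..L, u x * v'' x = ∫ x in (0 : ℝ)..L, u'' x * v x := by
  have hLagrange : ∫ x in (0 : ℝ)..L, (u x * v'' x - u'' x * v x) = 0 := by
    have h := ((hu.1.mul hv.2).sub (hu.2.mul hv.1)).congr_ae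
      (g' := fun x => u x * v'' x - u'' x * v x) (.of_forall fun x => by ring)
    rw [h.integral_eq_sub hL]
    simp [hu.3, hu.4, hv.3, hv.4]
  rw [← sub_eq_zero, ← intervalIntegral.integral_sub, hLagrange]
  · exact (hv.2.intervalIntegrable_deriv hL).continuousOn_mul
      (by rw [uIcc_of_le hL]; exact hu.1.continuousOn hL)
  · exact (hu.2.intervalIntegrable_deriv hL).mul_continuousOn
      (by rw [uIcc_of_le hL]; exact hv.1.continuousOn hL)

theorem nonneg (hL : 0 ≤ L) (hu : IsDirichlet L u u' u'') (hc : ContinuousOn u'' (Icc 0 L))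
    (hneg : ∀ x ∈ Icc 0 L, u'' x ≤ 0) {x : ℝ} (hx : x ∈ Icc 0 L) : 0 ≤ u x := by
  have hconcave : ConcaveOn ℝ (Icc 0 L) u := by
    refine concaveOn_of_hasDerivWithinAt2_nonpos (convex_Icc 0 L) (hu.1.continuousOn hL)
      (f' := u') (f'' := u'') ?_ ?_ fun x hx => hneg x (interior_subset hx)
    · exact fun x hx => (hu.1.hasDerivWithinAt (hu.2.continuousOn hL)
        (interior_subset hx)).mono interior_subset
    · exact fun x hx => (hu.2.hasDerivWithinAt hc (interior_subset hx)).mono interior_subset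
  simpa only [hu.3, hu.4, min_self] using hconcave.ge_on_segment (left_mem_Icc.2 hL)
    (right_mem_Icc.2 hL) (by rwa [segment_eq_Icc hL])

theorem abs_le (hL : 0 ≤ L) (hu : IsDirichlet L u u' u'') (hc : ContinuousOn u'' (Icc 0 L))
    {δ : ℝ} (hδ : ∀ x ∈ Icc 0 L, |u'' x| ≤ δ) {x : ℝ} (hx : x ∈ Icc 0 L) :
    |u x| ≤ δ * bump L x := by
  have hb := (isDirichlet_bump L).const_mul δ
  rw [_root_.abs_le]
  constructor
  · have h := (hb.add hu).nonneg hL (by fun_prop)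
      (fun t ht => by linarith [(_root_.abs_le.1 (hδ t ht)).2]) hx
    linarith
  · have h := (hb.sub hu).nonneg hL (by fun_prop)
      (fun t ht => by linarith [(_root_.abs_le.1 (hδ t ht)).1]) hx
    linarith

end IsDirichlet

/-- For a Dirichlet function `y` with `u = -y''`, the nonlocal term `∫ y` equals `moment L u`. -/
noncomputable def moment (L : ℝ) (u : ℝ → ℝ) : ℝ := ∫ x in (0 : ℝ)..L, bump L x * u x

theorem IsDirichlet.integral_eq_moment_neg {L : ℝ} {y y' y'' : ℝ → ℝ} (hL : 0 ≤ L)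
    (hy : IsDirichlet L y y' y'') : ∫ x in (0 : ℝ)..L, y x = moment L (fun x => -y'' x) := by
  simpa [moment, intervalIntegral.integral_neg] using
    congrArg Neg.neg ((isDirichlet_bump L).integral_mul_comm hL hy).symm

section Moment

variable {L : ℝ} {u v : ℝ → ℝ}

theorem moment_const_mul (k : ℝ) : moment L (fun x => k * u x) = k * moment L u := by
  simp only [moment, mul_left_comm _ k, intervalIntegral.integral_const_mul]

theorem moment_sub (hL : 0 ≤ L) (hu : ContinuousOn u (Icc 0 L)) (hv : ContinuousOn v (Icc 0 L)) :
    moment L (fun x => u x - v x) = moment L u - moment L v := by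
  simp only [moment, mul_sub]
  refine intervalIntegral.integral_sub ?_ ?_ <;>
    exact ContinuousOn.intervalIntegrable_of_Icc hL (by fun_prop)

theorem moment_add (hL : 0 ≤ L) (hu : ContinuousOn u (Icc 0 L)) (hv : ContinuousOn v (Icc 0 L)) :
    moment L (fun x => u x + v x) = moment L u + moment L v := by
  simp only [moment, mul_add]
  refine intervalIntegral.integral_add ?_ ?_ <;>
    exact ContinuousOn.intervalIntegrable_of_Icc hL (by fun_prop)

theorem moment_congr (hL : 0 ≤ L) (h : EqOn u v (Icc 0 L)) : moment L u = moment L v :=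
  intervalIntegral.integral_congr fun x hx => by
    rw [uIcc_of_le hL] at hx
    simp only [h hx]

theorem moment_mono (hL : 0 ≤ L) (hu : ContinuousOn u (Icc 0 L)) (hv : ContinuousOn v (Icc 0 L))
    (h : ∀ x ∈ Icc 0 L, u x ≤ v x) : moment L u ≤ moment L v := by
  refine intervalIntegral.integral_mono_on hL ?_ ?_
    fun x hx => mul_le_mul_of_nonneg_left (h x hx) (bump_nonneg hx) <;>
    exact ContinuousOn.intervalIntegrable_of_Icc hL (by fun_prop)

end Moment

section Helmholtz

variable {L m x : ℝ} {h w w' : ℝ → ℝ}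

theorem hasDerivAt_sinh_mul_sub (m x₀ x : ℝ) :
    HasDerivAt (fun x => Real.sinh (m * (x - x₀))) (m * Real.cosh (m * (x - x₀))) x := by
  simpa [mul_comm] using (((hasDerivAt_id x).sub_const x₀).const_mul m).sinh

theorem hasDerivAt_cosh_mul_sub (m x₀ x : ℝ) :
    HasDerivAt (fun x => Real.cosh (m * (x - x₀))) (m * Real.sinh (m * (x - x₀))) x := by
  simpa [mul_comm] using (((hasDerivAt_id x).sub_const x₀).const_mul m).cosh

theorem integral_sinh_mul_eq_sub {a b : ℝ} (hab : a ≤ b) (x₀ : ℝ) (hw : IsPrimitive a b w w')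
    (hw' : IsPrimitive a b w' (fun x => m ^ 2 * w x - h x)) :
    ∫ s in a..b, Real.sinh (m * (s - x₀)) * h s =
      (m * Real.cosh (m * (b - x₀)) * w b - Real.sinh (m * (b - x₀)) * w' b) -
        (m * Real.cosh (m * (a - x₀)) * w a - Real.sinh (m * (a - x₀)) * w' a) := by
  have hsinh : IsPrimitive a b (fun x => Real.sinh (m * (x - x₀)))
      (fun x => m * Real.cosh (m * (x - x₀))) :=
    .of_hasDerivAt (hasDerivAt_sinh_mul_sub m x₀) (by fun_prop)
  have hcosh : IsPrimitive a b (fun x => Real.cosh (m * (x - x₀)))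
      (fun x => m * Real.sinh (m * (x - x₀))) :=
    .of_hasDerivAt (hasDerivAt_cosh_mul_sub m x₀) (by fun_prop)
  exact ((((hcosh.const_mul m).mul hw).sub (hsinh.mul hw')).congr_ae
    (.of_forall fun x => by ring)).integral_eq_sub hab

/-- Sturm comparison with `m⁻¹ sinh (m x)`, the solution of `w'' = m² w`, `w 0 = 0`, `w' 0 = 1`. -/
theorem le_deriv_mul_sinh (hm : 0 < m) (hw : IsPrimitive 0 L w w')
    (hw' : IsPrimitive 0 L w' (fun x => m ^ 2 * w x - h x)) (hw₀ : w 0 = 0)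
    (hh : ∀ x ∈ Icc 0 L, 0 ≤ h x) (hx : x ∈ Icc 0 L) :
    w x ≤ w' 0 / m * Real.sinh (m * x) := by
  have hLagrange := integral_sinh_mul_eq_sub hx.1 x (hw.mono le_rfl hx.1 hx.2)
    (hw'.mono le_rfl hx.1 hx.2)
  have hneg : ∫ s in (0 : ℝ)..x, Real.sinh (m * (s - x)) * h s ≤ 0 := by
    rw [intervalIntegral.integral_of_le hx.1]
    exact setIntegral_nonpos measurableSet_Ioc fun s hs => mul_nonpos_of_nonpos_of_nonneg
      (Real.sinh_nonpos_iff.2 (mul_nonpos_of_nonneg_of_nonpos hm.le (sub_nonpos.2 hs.2)))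
      (hh s ⟨hs.1.le, hs.2.trans hx.2⟩)
  rw [hLagrange] at hneg
  simp only [sub_self, mul_zero, Real.cosh_zero, mul_one, Real.sinh_zero, zero_mul, sub_zero, hw₀,
    zero_sub, mul_neg, Real.sinh_neg, neg_mul, neg_neg] at hneg
  rw [div_mul_eq_mul_div, le_div_iff₀ hm]
  linarith

/-- The Green kernel of `-d²/dx² + m²` on `[0, L]` with Dirichlet boundary conditions. -/
noncomputable def greenKernel (L m x s : ℝ) : ℝ :=
  Real.sinh (m * min x s) * Real.sinh (m * (L - max x s)) / (m * Real.sinh (m * L))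

theorem greenKernel_reflect (L m x s : ℝ) :
    greenKernel L m (L - x) (L - s) = greenKernel L m x s := by
  rw [greenKernel, greenKernel, min_sub_sub_left, max_sub_sub_left, sub_sub_cancel, mul_comm]

theorem greenKernel_nonneg (hm : 0 < m) {s : ℝ} (hx : x ∈ Icc 0 L) (hs : s ∈ Icc 0 L) :
    0 ≤ greenKernel L m x s := by
  have hmin : 0 ≤ min x s := le_min hx.1 hs.1
  have hmax : 0 ≤ L - max x s := sub_nonneg.2 (max_le hx.2 hs.2)
  have hL : 0 ≤ L := hx.1.trans hx.2
  refine div_nonneg (mul_nonneg ?_ ?_) (mul_nonneg hm.le ?_) <;>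
    exact Real.sinh_nonneg_iff.2 (by positivity)

@[fun_prop]
theorem continuous_greenKernel (L m x : ℝ) : Continuous (greenKernel L m x) := by
  unfold greenKernel; fun_prop

theorem integral_greenKernel_mul_left (hw : IsPrimitive 0 L w w')
    (hw' : IsPrimitive 0 L w' (fun x => m ^ 2 * w x - h x)) (hw₀ : w 0 = 0) (hx : x ∈ Icc 0 L) :
    ∫ s in (0 : ℝ)..x, greenKernel L m x s * h s =
      Real.sinh (m * (L - x)) / (m * Real.sinh (m * L)) *
        (m * Real.cosh (m * x) * w x - Real.sinh (m * x) * w' x) := by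
  have hLagrange := integral_sinh_mul_eq_sub hx.1 0 (hw.mono le_rfl hx.1 hx.2)
    (hw'.mono le_rfl hx.1 hx.2)
  simp only [sub_zero, hw₀, mul_zero, Real.sinh_zero, zero_mul] at hLagrange
  rw [← hLagrange, ← intervalIntegral.integral_const_mul]
  refine intervalIntegral.integral_congr fun s hs => ?_
  rw [uIcc_of_le hx.1] at hs
  simp only [greenKernel, min_eq_right hs.2, max_eq_left hs.2]
  ring

theorem integral_greenKernel_mul_right (hw : IsPrimitive 0 L w w')
    (hw' : IsPrimitive 0 L w' (fun x => m ^ 2 * w x - h x)) (hwL : w L = 0) (hx : x ∈ Icc 0 L) :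
    ∫ s in x..L, greenKernel L m x s * h s =
      Real.sinh (m * x) / (m * Real.sinh (m * L)) *
        (m * Real.cosh (m * (L - x)) * w x + Real.sinh (m * (L - x)) * w' x) := by
  have hLagrange := integral_sinh_mul_eq_sub hx.2 L (hw.mono hx.1 hx.2 le_rfl)
    (hw'.mono hx.1 hx.2 le_rfl)
  rw [← neg_sub L x, mul_neg, Real.cosh_neg, Real.sinh_neg] at hLagrange
  simp only [sub_self, hwL, mul_zero, Real.sinh_zero, zero_mul] at hLagrange
  rw [show m * Real.cosh (m * (L - x)) * w x + Real.sinh (m * (L - x)) * w' x =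
      -∫ s in x..L, Real.sinh (m * (s - L)) * h s by rw [hLagrange]; ring,
    ← intervalIntegral.integral_neg, ← intervalIntegral.integral_const_mul]
  refine intervalIntegral.integral_congr fun s hs => ?_
  rw [uIcc_of_le hx.2] at hs
  simp only [greenKernel, min_eq_left hs.1, max_eq_right hs.1, ← neg_sub L s, mul_neg,
    Real.sinh_neg]
  ring

theorem IsDirichlet.eq_integral_greenKernel (hL : 0 < L) (hm : 0 < m)
    (hw : IsDirichlet L w w' (fun x => m ^ 2 * w x - h x)) (hh : IntervalIntegrable h volume 0 L)
    (hx : x ∈ Icc 0 L) : w x = ∫ s in (0 : ℝ)..L, greenKernel L m x s * h s := by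
  have hK : 0 < m * Real.sinh (m * L) := mul_pos hm (Real.sinh_pos_iff.2 (by positivity))
  have hint : IntervalIntegrable (fun s => greenKernel L m x s * h s) volume 0 L :=
    hh.continuousOn_mul (by fun_prop)
  have hadd : Real.sinh (m * L) = Real.sinh (m * x) * Real.cosh (m * (L - x)) +
      Real.cosh (m * x) * Real.sinh (m * (L - x)) := by
    rw [← Real.sinh_add]; ring_nf
  have hxL : x ∈ uIcc 0 L := by rwa [uIcc_of_le hL.le]
  rw [← intervalIntegral.integral_add_adjacent_intervals
      (hint.mono_set (uIcc_subset_uIcc_left hxL)) (hint.mono_set (uIcc_subset_uIcc_right hxL)),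
    integral_greenKernel_mul_left hw.1 hw.2 hw.3 hx,
    integral_greenKernel_mul_right hw.1 hw.2 hw.4 hx,
    div_mul_eq_mul_div, div_mul_eq_mul_div, ← add_div, eq_div_iff hK.ne', hadd]
  ring

theorem IsDirichlet.integral_mul_eq_integral_mul (hL : 0 ≤ L) {f g v v' : ℝ → ℝ}
    (hw : IsDirichlet L w w' (fun x => m ^ 2 * w x - f x))
    (hv : IsDirichlet L v v' (fun x => m ^ 2 * v x - g x))
    (hf : IntervalIntegrable f volume 0 L) (hg : IntervalIntegrable g volume 0 L) :
    ∫ x in (0 : ℝ)..L, f x * v x = ∫ x in (0 : ℝ)..L, w x * g x := by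
  have hcw : ContinuousOn w (uIcc 0 L) := uIcc_of_le hL ▸ hw.1.continuousOn hL
  have hcv : ContinuousOn v (uIcc 0 L) := uIcc_of_le hL ▸ hv.1.continuousOn hL
  have hvw : IntervalIntegrable (fun x => m ^ 2 * w x * v x) volume 0 L :=
    ContinuousOn.intervalIntegrable (by fun_prop)
  have hcomm := hw.integral_mul_comm hL hv
  have hl : ∀ x, w x * (m ^ 2 * v x - g x) = m ^ 2 * w x * v x - w x * g x := fun x => by ring
  simp only [hl, sub_mul] at hcomm
  rw [intervalIntegral.integral_sub hvw (hg.continuousOn_mul hcw),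
    intervalIntegral.integral_sub hvw (hf.mul_continuousOn hcv)] at hcomm
  linarith

end Helmholtz

section Hyperbolic

variable {t : ℝ}

theorem sinh_le_mul_cosh (ht : 0 ≤ t) : Real.sinh t ≤ t * Real.cosh t := by
  have hd (x : ℝ) : HasDerivAt (fun x => x * Real.cosh x - Real.sinh x) (x * Real.sinh x) x := by
    refine (((hasDerivAt_id x).mul (Real.hasDerivAt_cosh x)).sub
      (Real.hasDerivAt_sinh x)).congr_deriv ?_
    simp
  have hmono : MonotoneOn (fun x : ℝ => x * Real.cosh x - Real.sinh x) (Ici 0) := by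
    refine monotoneOn_of_deriv_nonneg (convex_Ici 0) (by fun_prop)
      (fun x _ => (hd x).differentiableAt.differentiableWithinAt) fun x hx => ?_
    rw [interior_Ici, mem_Ioi] at hx
    rw [(hd x).deriv]
    exact mul_nonneg hx.le (Real.sinh_nonneg_iff.2 hx.le)
  simpa using hmono self_mem_Ici ht ht

theorem tanh_le_self (ht : 0 ≤ t) : Real.tanh t ≤ t := by
  rw [Real.tanh_eq_sinh_div_cosh, div_le_iff₀ (Real.cosh_pos t)]
  exact sinh_le_mul_cosh ht

theorem sinh_eq_two_mul_half (t : ℝ) :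
    Real.sinh t = 2 * Real.sinh (t / 2) * Real.cosh (t / 2) := by
  rw [← Real.sinh_two_mul, mul_div_cancel₀ t two_ne_zero]

theorem cosh_eq_two_mul_sq_half_sub_one (t : ℝ) :
    Real.cosh t = 2 * Real.cosh (t / 2) ^ 2 - 1 := by
  rw [← mul_div_cancel₀ t two_ne_zero, Real.cosh_two_mul, mul_div_cancel₀ t two_ne_zero,
    Real.sinh_sq]
  ring

theorem two_mul_cosh_sub_one_le (ht : 0 ≤ t) : 2 * (Real.cosh t - 1) ≤ t * Real.sinh t := by
  calc 2 * (Real.cosh t - 1) = 4 * Real.sinh (t / 2) * Real.sinh (t / 2) := by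
        rw [cosh_eq_two_mul_sq_half_sub_one, Real.cosh_sq]; ring
    _ ≤ 4 * Real.sinh (t / 2) * (t / 2 * Real.cosh (t / 2)) := by
        gcongr; exact sinh_le_mul_cosh (by positivity)
    _ = t * Real.sinh t := by rw [sinh_eq_two_mul_half t]; ring

theorem sigma_denom_pos (ht : 0 < t) :
    0 < 6 * t * Real.cosh t + 6 * t - 12 * Real.sinh t - t ^ 3 := by
  let f : ℝ → ℝ := fun t => 6 * t * Real.cosh t + 6 * t - 12 * Real.sinh t - t ^ 3
  have hd (x : ℝ) : HasDerivAt f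
      (6 * x * Real.sinh x - 6 * Real.cosh x + 6 - 3 * x ^ 2) x := by
    refine ((((((hasDerivAt_id x).const_mul 6).mul (Real.hasDerivAt_cosh x)).add
      ((hasDerivAt_id x).const_mul 6)).sub ((Real.hasDerivAt_sinh x).const_mul 12)).sub
      (hasDerivAt_pow 3 x)).congr_deriv ?_
    simp; ring
  have hmono : StrictMonoOn f (Ici 0) := by
    refine strictMonoOn_of_deriv_pos (convex_Ici 0)
      (fun x _ => (hd x).continuousAt.continuousWithinAt) fun x hx => ?_
    rw [interior_Ici, mem_Ioi] at hx
    rw [(hd x).deriv]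
    nlinarith [two_mul_cosh_sub_one_le hx.le,
      mul_lt_mul_of_pos_left (Real.self_lt_sinh_iff.2 hx) hx]
  simpa [f] using hmono self_mem_Ici ht.le ht

end Hyperbolic

section Resolvents

variable {L m x : ℝ}

/-- The solution of `-τ'' + m² τ = 1`, `τ 0 = τ L = 0`. -/
noncomputable def resolventOne (L m x : ℝ) : ℝ :=
  (1 - Real.cosh (m * (x - L / 2)) / Real.cosh (m * L / 2)) / m ^ 2

/-- The solution of `-q'' + m² q = bump`, `q 0 = q L = 0`. -/
noncomputable def resolventBump (L m x : ℝ) : ℝ :=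
  (m ^ 2)⁻¹ * (bump L x - resolventOne L m x)

theorem resolventOne_reflect (L m x : ℝ) : resolventOne L m (L - x) = resolventOne L m x := by
  rw [resolventOne, resolventOne, show m * (L - x - L / 2) = -(m * (x - L / 2)) by ring,
    Real.cosh_neg]

theorem resolventBump_reflect (L m x : ℝ) : resolventBump L m (L - x) = resolventBump L m x := by
  rw [resolventBump, resolventBump, resolventOne_reflect, bump, bump, sub_sub_cancel, mul_comm x]

@[fun_prop]
theorem continuous_resolventOne (L m : ℝ) : Continuous (resolventOne L m) := by
  unfold resolventOne; fun_prop

@[fun_prop]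
theorem continuous_resolventBump (L m : ℝ) : Continuous (resolventBump L m) := by
  unfold resolventBump; fun_prop

theorem isDirichlet_resolventOne (hm : 0 < m) : IsDirichlet L (resolventOne L m)
    (fun x => -(Real.sinh (m * (x - L / 2)) / (m * Real.cosh (m * L / 2))))
    (fun x => m ^ 2 * resolventOne L m x - 1) where
  primitive := by
    refine .of_hasDerivAt (fun x => ?_) (by fun_prop)
    refine ((((hasDerivAt_cosh_mul_sub m (L / 2) x).div_const
      (Real.cosh (m * L / 2))).const_sub 1).div_const (m ^ 2)).congr_deriv ?_
    field_simp
  primitive' := by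
    refine .of_hasDerivAt (fun x => ?_) (by fun_prop)
    refine ((hasDerivAt_sinh_mul_sub m (L / 2) x).div_const
      (m * Real.cosh (m * L / 2))).neg.congr_deriv ?_
    rw [resolventOne]
    field_simp
    ring
  left := by
    rw [resolventOne, zero_sub, mul_neg, Real.cosh_neg, ← mul_div_assoc,
      div_self (Real.cosh_pos _).ne', sub_self, zero_div]
  right := by
    rw [resolventOne, sub_half, ← mul_div_assoc, div_self (Real.cosh_pos _).ne', sub_self, zero_div]

theorem isDirichlet_resolventBump (hm : 0 < m) : IsDirichlet L (resolventBump L m)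
    (fun x => (m ^ 2)⁻¹ *
      (L / 2 - x - -(Real.sinh (m * (x - L / 2)) / (m * Real.cosh (m * L / 2)))))
    (fun x => m ^ 2 * resolventBump L m x - bump L x) :=
  (((isDirichlet_bump L).sub (isDirichlet_resolventOne hm)).const_mul (m ^ 2)⁻¹).congr_ae <|
    .of_forall fun x => by
      simp only [resolventBump]
      field_simp
      ring

theorem resolventOne_le_mul_sinh (hm : 0 < m) (hx : x ∈ Icc 0 L) :
    resolventOne L m x ≤ Real.tanh (m * L / 2) / m ^ 2 * Real.sinh (m * x) := by
  have hτ := isDirichlet_resolventOne (L := L) hm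
  refine (le_deriv_mul_sinh hm hτ.1 hτ.2 hτ.3 (fun _ _ => zero_le_one) hx).trans_eq ?_
  rw [zero_sub, mul_neg, Real.sinh_neg, Real.tanh_eq_sinh_div_cosh]
  field_simp

theorem resolventBump_le_mul_sinh (hm : 0 < m) (hx : x ∈ Icc 0 L) :
    resolventBump L m x ≤
      (L / 2 - Real.tanh (m * L / 2) / m) / m ^ 3 * Real.sinh (m * x) := by
  have hq := isDirichlet_resolventBump (L := L) hm
  refine (le_deriv_mul_sinh hm hq.1 hq.2 hq.3 (fun _ => bump_nonneg) hx).trans_eq ?_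
  rw [zero_sub, mul_neg, Real.sinh_neg, Real.tanh_eq_sinh_div_cosh]
  field_simp
  ring

theorem resolventOne_nonneg (hL : 0 < L) (hm : 0 < m) (hx : x ∈ Icc 0 L) :
    0 ≤ resolventOne L m x := by
  rw [(isDirichlet_resolventOne hm).eq_integral_greenKernel hL hm
    (continuous_const.intervalIntegrable _ _) hx]
  exact intervalIntegral.integral_nonneg hL.le fun s hs =>
    mul_nonneg (greenKernel_nonneg hm hx hs) zero_le_one

theorem resolventOne_le (hL : 0 ≤ L) (hm : 0 < m) (x : ℝ) :
    resolventOne L m x ≤ L * (Real.tanh (m * L / 2) / (2 * m)) := by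
  have hc := Real.cosh_pos (m * L / 2)
  have hmid : 1 / Real.cosh (m * L / 2) ≤
      Real.cosh (m * (x - L / 2)) / Real.cosh (m * L / 2) := by
    gcongr
    exact Real.one_le_cosh _
  have htanh : 1 - 1 / Real.cosh (m * L / 2) ≤ m * L / 2 * Real.tanh (m * L / 2) := by
    rw [Real.tanh_eq_sinh_div_cosh, ← mul_div_assoc, one_sub_div hc.ne']
    gcongr
    linarith [two_mul_cosh_sub_one_le (t := m * L / 2) (by positivity),
      Real.one_le_cosh (m * L / 2)]
  calc resolventOne L m x ≤ (m * L / 2 * Real.tanh (m * L / 2)) / m ^ 2 := by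
        rw [resolventOne]; gcongr; linarith
    _ = _ := by field_simp

theorem moment_resolventOne (hL : 0 ≤ L) (hm : 0 < m) : moment L (resolventOne L m) =
    (L ^ 3 / 12 - (L - 2 * Real.tanh (m * L / 2) / m) / m ^ 2) / m ^ 2 := by
  have hτ := isDirichlet_resolventOne (L := L) hm
  have hint : ∀ {f : ℝ → ℝ}, Continuous f → IntervalIntegrable f volume 0 L :=
    fun hf => hf.intervalIntegrable _ _
  have hmass : ∫ x in (0 : ℝ)..L, resolventOne L m x =
      (L - 2 * Real.tanh (m * L / 2) / m) / m ^ 2 := by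
    have h := hτ.2.integral_eq_sub hL
    rw [intervalIntegral.integral_sub (hint (by fun_prop)) (hint (by fun_prop)),
      intervalIntegral.integral_const_mul, integral_one, sub_zero, zero_sub, sub_half, mul_neg,
      Real.sinh_neg, ← mul_div_assoc] at h
    rw [Real.tanh_eq_sinh_div_cosh, eq_div_iff (by positivity), mul_comm,
      eq_add_of_sub_eq h]
    field_simp
    ring
  have hcomm : m ^ 2 * moment L (resolventOne L m) - L ^ 3 / 12 =
      -∫ x in (0 : ℝ)..L, resolventOne L m x := by
    have h := (isDirichlet_bump L).integral_mul_comm hL hτ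
    simp only [mul_sub, mul_one, mul_left_comm _ (m ^ 2), neg_mul, one_mul] at h
    rwa [intervalIntegral.integral_sub (hint (by fun_prop)) (hint (by fun_prop)),
      intervalIntegral.integral_const_mul, integral_bump, intervalIntegral.integral_neg] at h
  rw [eq_div_iff (by positivity), ← hmass]
  linarith

theorem mul_resolvent_coeff_le {N : ℝ} (hL : 0 < L) (hm : 0 < m)
    (hN : N ≤ 4 * m ^ 2 / L ^ 3 * sigma (m * L)) :
    N * (Real.tanh (m * L / 2) / m ^ 2 * ((L / 2 - Real.tanh (m * L / 2) / m) / m ^ 3)) ≤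
      (1 + N * moment L (resolventOne L m)) / (m * Real.sinh (m * L)) := by
  have hden := sigma_denom_pos (t := m * L) (by positivity)
  have hsigma : N * (6 * (m * L) * Real.cosh (m * L) + 6 * (m * L) - 12 * Real.sinh (m * L)
      - (m * L) ^ 3) ≤ 12 * m ^ 5 := by
    calc _ ≤ 4 * m ^ 2 / L ^ 3 * sigma (m * L) * _ := mul_le_mul_of_nonneg_right hN hden.le
      _ = 12 * m ^ 5 := by
        rw [sigma, mul_assoc, div_mul_cancel₀ _ hden.ne']
        field_simp
        ring
  have hcoeff : Real.tanh (m * L / 2) / m ^ 2 * ((L / 2 - Real.tanh (m * L / 2) / m) / m ^ 3) *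
        (m * Real.sinh (m * L)) - moment L (resolventOne L m) =
      (6 * (m * L) * Real.cosh (m * L) + 6 * (m * L) - 12 * Real.sinh (m * L) - (m * L) ^ 3) /
        (12 * m ^ 5) := by
    rw [moment_resolventOne hL.le hm, sinh_eq_two_mul_half (m * L),
      cosh_eq_two_mul_sq_half_sub_one (m * L), Real.tanh_eq_sinh_div_cosh]
    field_simp
    rw [Real.sinh_sq]
    ring
  rw [le_div_iff₀ (by positivity), mul_assoc, eq_add_of_sub_eq hcoeff, mul_add, ← mul_div_assoc]
  gcongr
  exact div_le_one_of_le₀ hsigma (by positivity)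

/-- The kernel of `h ↦ (1 + N κ) w - N (∫ q h) τ`, where `w` solves `w'' = m² w - h` and
`κ = moment L τ`, is nonnegative. -/
theorem resolvent_mul_le_greenKernel {N s : ℝ} (hL : 0 < L) (hm : 0 < m) (hN₀ : 0 ≤ N)
    (hN : N ≤ 4 * m ^ 2 / L ^ 3 * sigma (m * L)) (hx : x ∈ Icc 0 L) (hs : s ∈ Icc 0 L) :
    N * (resolventOne L m x * resolventBump L m s) ≤
      (1 + N * moment L (resolventOne L m)) * greenKernel L m x s := by
  wlog hxs : x ≤ s generalizing x s
  · have hreflect : ∀ t ∈ Icc 0 L, L - t ∈ Icc 0 L := fun t ht =>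
      ⟨sub_nonneg.2 ht.2, sub_le_self L ht.1⟩
    simpa only [resolventOne_reflect, resolventBump_reflect, greenKernel_reflect] using
      this (hreflect x hx) (hreflect s hs) (by linarith)
  have hLs : L - s ∈ Icc 0 L := ⟨sub_nonneg.2 hs.2, sub_le_self L hs.1⟩
  have hsinh : ∀ t ∈ Icc 0 L, 0 ≤ Real.sinh (m * t) := fun t ht =>
    Real.sinh_nonneg_iff.2 (mul_nonneg hm.le ht.1)
  have hC : 0 ≤ (L / 2 - Real.tanh (m * L / 2) / m) / m ^ 3 := by
    refine div_nonneg (sub_nonneg.2 ?_) (by positivity)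
    rw [div_le_iff₀ hm]
    exact (tanh_le_self (by positivity)).trans_eq (by ring)
  calc N * (resolventOne L m x * resolventBump L m s)
      ≤ N * (Real.tanh (m * L / 2) / m ^ 2 * Real.sinh (m * x) *
          ((L / 2 - Real.tanh (m * L / 2) / m) / m ^ 3 * Real.sinh (m * (L - s)))) := by
        refine mul_le_mul_of_nonneg_left (mul_le_mul_of_nonneg (resolventOne_le_mul_sinh hm hx)
          ?_ (resolventOne_nonneg hL hm hx) (mul_nonneg hC (hsinh _ hLs))) hN₀
        rw [← resolventBump_reflect]
        exact resolventBump_le_mul_sinh hm hLs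
    _ = N * (Real.tanh (m * L / 2) / m ^ 2 * ((L / 2 - Real.tanh (m * L / 2) / m) / m ^ 3)) *
          (Real.sinh (m * x) * Real.sinh (m * (L - s))) := by ring
    _ ≤ (1 + N * moment L (resolventOne L m)) / (m * Real.sinh (m * L)) *
          (Real.sinh (m * x) * Real.sinh (m * (L - s))) :=
        mul_le_mul_of_nonneg_right (mul_resolvent_coeff_le hL hm hN)
          (mul_nonneg (hsinh x hx) (hsinh _ hLs))
    _ = (1 + N * moment L (resolventOne L m)) * greenKernel L m x s := by
        rw [greenKernel, min_eq_left hxs, max_eq_right hxs]; ring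

end Resolvents

section Existence

variable {L : ℝ} {h : ℝ → ℝ}

theorem exists_isPrimitive_mul_add (hL : 0 ≤ L) (k : ℝ) (hh : IntervalIntegrable h volume 0 L) :
    ∃ z, IsPrimitive 0 L z (fun x => k * z x + h x) ∧ z 0 = 0 := by
  have hexp : IsPrimitive 0 L (fun x => Real.exp (k * x)) (fun x => k * Real.exp (k * x)) :=
    .of_hasDerivAt (fun x => by simpa [mul_comm] using ((hasDerivAt_id x).const_mul k).exp)
      (by fun_prop)
  have hint := IsPrimitive.integral hL (hh.continuousOn_mul (g := fun x => Real.exp (-(k * x)))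
    (by fun_prop))
  refine ⟨_, (hexp.mul hint).congr_ae (.of_forall fun x => ?_), by simp⟩
  simp only [← mul_assoc, ← Real.exp_add, add_neg_cancel, Real.exp_zero, one_mul]

/-- The operator factors as `d²/dx² - m² = (d/dx + m) (d/dx - m)`. -/
theorem exists_isDirichlet_helmholtz {m : ℝ} (hL : 0 < L) (hm : 0 < m)
    (hh : IntervalIntegrable h volume 0 L) :
    ∃ w w', IsDirichlet L w w' (fun x => m ^ 2 * w x - h x) := by
  obtain ⟨v, hv, -⟩ := exists_isPrimitive_mul_add hL.le (-m) hh.neg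
  obtain ⟨w, hw, hw₀⟩ := exists_isPrimitive_mul_add hL.le m (hv.intervalIntegrable hL.le)
  have hsinh : IsPrimitive 0 L (fun x => Real.sinh (m * (x - 0)))
      (fun x => m * Real.cosh (m * (x - 0))) :=
    .of_hasDerivAt (hasDerivAt_sinh_mul_sub m 0) (by fun_prop)
  have hcosh : IsPrimitive 0 L (fun x => Real.cosh (m * (x - 0)))
      (fun x => m * Real.sinh (m * (x - 0))) :=
    .of_hasDerivAt (hasDerivAt_cosh_mul_sub m 0) (by fun_prop)
  have hsL : Real.sinh (m * (L - 0)) ≠ 0 := (Real.sinh_pos_iff.2 (by simpa using by positivity)).ne'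
  set k := w L / Real.sinh (m * (L - 0)) with hk
  refine ⟨_, _, hw.sub (hsinh.const_mul k),
    (((hw.const_mul m).add hv).sub ((hcosh.const_mul m).const_mul k)).congr_ae
      (.of_forall fun x => ?_), ?_, ?_⟩
  · simp only [Pi.neg_apply]; ring
  · simp [hw₀]
  · simp only [hk, div_mul_cancel₀ _ hsL, sub_self]

end Existence

/-- `u` solves `-u'' + m² u + N ∫₀ᴸ bump u = h`, `u 0 = u L = 0`. This is the linear problem
`y'''' - m² y'' + N ∫₀ᴸ y = h` written for `u = -y''`. -/
def IsLinearSolution (L m N : ℝ) (h u : ℝ → ℝ) : Prop :=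
  ∃ u', IsDirichlet L u u' (fun x => m ^ 2 * u x + N * moment L u - h x)

namespace IsLinearSolution

variable {L m N : ℝ} {h g u v : ℝ → ℝ}

theorem continuousOn (hL : 0 ≤ L) (hu : IsLinearSolution L m N h u) :
    ContinuousOn u (Icc 0 L) :=
  let ⟨_, hu⟩ := hu
  hu.1.continuousOn hL

theorem intervalIntegrable (hL : 0 ≤ L) (hu : IsLinearSolution L m N h u) :
    IntervalIntegrable h volume 0 L := by
  have hc := hu.continuousOn hL
  obtain ⟨u', hu⟩ := hu
  have hleft : IntervalIntegrable (fun x => m ^ 2 * u x + N * moment L u) volume 0 L :=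
    ContinuousOn.intervalIntegrable_of_Icc hL (by fun_prop)
  simpa using hleft.sub (hu.2.intervalIntegrable_deriv hL)

theorem add (hL : 0 ≤ L) (hu : IsLinearSolution L m N h u) (hv : IsLinearSolution L m N g v) :
    IsLinearSolution L m N (fun x => h x + g x) (fun x => u x + v x) := by
  have hmoment := moment_add hL (hu.continuousOn hL) (hv.continuousOn hL)
  obtain ⟨u', hu⟩ := hu
  obtain ⟨v', hv⟩ := hv
  refine ⟨_, (hu.add hv).congr_ae (.of_forall fun x => ?_)⟩
  rw [hmoment]; ring

theorem const_mul (k : ℝ) (hu : IsLinearSolution L m N h u) :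
    IsLinearSolution L m N (fun x => k * h x) (fun x => k * u x) := by
  obtain ⟨u', hu⟩ := hu
  refine ⟨_, (hu.const_mul k).congr_ae (.of_forall fun x => ?_)⟩
  rw [moment_const_mul]; ring

theorem sub (hL : 0 ≤ L) (hu : IsLinearSolution L m N h u) (hv : IsLinearSolution L m N g v) :
    IsLinearSolution L m N (fun x => h x - g x) (fun x => u x - v x) := by
  simpa [sub_eq_add_neg] using hu.add hL (hv.const_mul (-1))

theorem congr_ae (hu : IsLinearSolution L m N h u)
    (hhg : ∀ᵐ x ∂volume.restrict (Ioo 0 L), h x = g x) : IsLinearSolution L m N g u := by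
  obtain ⟨u', hu⟩ := hu
  exact ⟨u', hu.congr_ae (hhg.mono fun x hx => by rw [hx])⟩

end IsLinearSolution

section Comparison

variable {L m N : ℝ} {h g u v : ℝ → ℝ}

theorem isLinearSolution_resolventOne (N : ℝ) (hm : 0 < m) :
    IsLinearSolution L m N (fun _ => 1 + N * moment L (resolventOne L m)) (resolventOne L m) :=
  ⟨_, (isDirichlet_resolventOne hm).congr_ae (.of_forall fun x => by ring)⟩

theorem one_le_one_add_mul_moment_resolventOne (hL : 0 < L) (hm : 0 < m) (hN : 0 ≤ N) :
    1 ≤ 1 + N * moment L (resolventOne L m) :=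
  le_add_of_nonneg_right <| mul_nonneg hN <| intervalIntegral.integral_nonneg hL.le
    fun _ hx => mul_nonneg (bump_nonneg hx) (resolventOne_nonneg hL hm hx)

theorem exists_isLinearSolution (hL : 0 < L) (hm : 0 < m) (hN : 0 ≤ N)
    (hh : IntervalIntegrable h volume 0 L) : ∃ u, IsLinearSolution L m N h u := by
  obtain ⟨w, w', hw⟩ := exists_isDirichlet_helmholtz hL hm hh
  have hlocal : IsLinearSolution L m N (fun x => h x + N * moment L w) w :=
    ⟨w', hw.congr_ae (.of_forall fun x => by ring)⟩
  have hone := one_le_one_add_mul_moment_resolventOne hL hm hN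
  set κ := 1 + N * moment L (resolventOne L m)
  refine ⟨_, (hlocal.sub hL.le ((isLinearSolution_resolventOne N hm).const_mul
    (N * moment L w / κ))).congr_ae (.of_forall fun x => ?_)⟩
  rw [div_mul_cancel₀ _ (zero_lt_one.trans_le hone).ne', add_sub_cancel_right]

/-- Adding `N ∫ bump u` times `resolventOne` to `u` removes the nonlocal term, so that the Green
kernel applies. -/
theorem IsLinearSolution.mul_eq_integral (hL : 0 < L) (hm : 0 < m)
    (hu : IsLinearSolution L m N h u) {x : ℝ} (hx : x ∈ Icc 0 L) :
    (1 + N * moment L (resolventOne L m)) * u x =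
      ∫ s in (0 : ℝ)..L, ((1 + N * moment L (resolventOne L m)) * greenKernel L m x s -
        N * (resolventOne L m x * resolventBump L m s)) * h s := by
  have hh := hu.intervalIntegrable hL.le
  have hcu := hu.continuousOn hL.le
  obtain ⟨u', hu⟩ := hu
  have hτ := (isDirichlet_resolventOne (L := L) hm).const_mul (N * moment L u)
  have hv := (hu.add hτ).congr_ae (v'' := fun x =>
    m ^ 2 * (u x + N * moment L u * resolventOne L m x) - h x) (.of_forall fun x => by ring)
  have hgreen := hv.eq_integral_greenKernel hL hm hh hx
  have hmoment : moment L (fun x => u x + N * moment L u * resolventOne L m x) =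
      ∫ s in (0 : ℝ)..L, resolventBump L m s * h s :=
    (isDirichlet_resolventBump hm).integral_mul_eq_integral_mul hL.le hv
      ((continuous_bump L).intervalIntegrable _ _) hh
  rw [moment_add hL.le hcu (by fun_prop), moment_const_mul] at hmoment
  simp only [sub_mul, mul_assoc]
  rw [intervalIntegral.integral_sub, intervalIntegral.integral_const_mul,
    intervalIntegral.integral_const_mul, intervalIntegral.integral_const_mul, ← hgreen, ← hmoment]
  · ring
  · exact (hh.continuousOn_mul (by fun_prop)).const_mul _
  · exact ((hh.continuousOn_mul (by fun_prop)).const_mul _).const_mul _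

theorem IsLinearSolution.nonneg (hL : 0 < L) (hm : 0 < m) (hN : 0 ≤ N)
    (hσ : N ≤ 4 * m ^ 2 / L ^ 3 * sigma (m * L)) (hu : IsLinearSolution L m N h u)
    (hh : ∀ᵐ x ∂volume.restrict (Ioo 0 L), 0 ≤ h x) {x : ℝ} (hx : x ∈ Icc 0 L) : 0 ≤ u x := by
  have hone := one_le_one_add_mul_moment_resolventOne hL hm hN
  refine nonneg_of_mul_nonneg_right ?_ (zero_lt_one.trans_le hone)
  rw [hu.mul_eq_integral hL hm hx]
  refine intervalIntegral.integral_nonneg_of_ae_restrict hL.le ?_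
  rw [restrict_Ioo_eq_restrict_Icc] at hh
  filter_upwards [hh, ae_restrict_mem measurableSet_Icc] with s hs hsL
  exact mul_nonneg (sub_nonneg.2 (resolvent_mul_le_greenKernel hL hm hN hσ hx hsL)) hs

theorem IsLinearSolution.mono (hL : 0 < L) (hm : 0 < m) (hN : 0 ≤ N)
    (hσ : N ≤ 4 * m ^ 2 / L ^ 3 * sigma (m * L)) (hu : IsLinearSolution L m N h u)
    (hv : IsLinearSolution L m N g v) (hhg : ∀ᵐ x ∂volume.restrict (Ioo 0 L), h x ≤ g x)
    {x : ℝ} (hx : x ∈ Icc 0 L) : u x ≤ v x :=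
  sub_nonneg.1 <| (hv.sub hL.le hu).nonneg hL hm hN hσ (hhg.mono fun _ => sub_nonneg.2) hx

theorem IsLinearSolution.abs_le (hL : 0 < L) (hm : 0 < m) (hN : 0 ≤ N)
    (hσ : N ≤ 4 * m ^ 2 / L ^ 3 * sigma (m * L)) (hu : IsLinearSolution L m N h u) {δ : ℝ}
    (hδ : 0 ≤ δ) (hh : ∀ᵐ x ∂volume.restrict (Ioo 0 L), |h x| ≤ δ) {x : ℝ} (hx : x ∈ Icc 0 L) :
    |u x| ≤ L * (Real.tanh (m * L / 2) / (2 * m)) * δ := by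
  have hτ := (isLinearSolution_resolventOne (L := L) N hm).const_mul δ
  have hdom : δ ≤ δ * (1 + N * moment L (resolventOne L m)) :=
    le_mul_of_one_le_right hδ (one_le_one_add_mul_moment_resolventOne hL hm hN)
  have hupper := hu.mono hL hm hN hσ hτ (hh.mono fun t ht => (_root_.abs_le.1 ht).2.trans hdom) hx
  have hlower := (hu.const_mul (-1)).mono hL hm hN hσ hτ
    (hh.mono fun t ht => by linarith [(_root_.abs_le.1 ht).1]) hx
  have hmax := mul_le_mul_of_nonneg_left (resolventOne_le hL.le hm x) hδ
  rw [_root_.abs_le]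
  constructor <;> linarith

end Comparison

section SupNorm

variable {L : ℝ} {g : ℝ → ℝ}

theorem supNorm_nonneg (L : ℝ) (g : ℝ → ℝ) : 0 ≤ supNorm L g :=
  Real.sSup_nonneg <| by rintro _ ⟨x, -, rfl⟩; exact abs_nonneg _

theorem supNorm_le {C : ℝ} (hL : 0 ≤ L) (h : ∀ x ∈ Icc 0 L, |g x| ≤ C) : supNorm L g ≤ C :=
  csSup_le ((nonempty_Icc.2 hL).image _) (forall_mem_image.2 h)

theorem abs_le_supNorm (hg : ContinuousOn g (Icc 0 L)) {x : ℝ} (hx : x ∈ Icc 0 L) :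
    |g x| ≤ supNorm L g :=
  le_csSup (isCompact_Icc.bddAbove_image hg.abs) ⟨x, hx, rfl⟩

theorem tendstoUniformlyOn_of_supNorm_le {Y : ℕ → ℝ → ℝ} {y : ℝ → ℝ} {e : ℕ → ℝ}
    (hcont : ∀ n, ContinuousOn (fun x => Y n x - y x) (Icc 0 L))
    (hle : ∀ n, supNorm L (fun x => Y n x - y x) ≤ e n) (he : Tendsto e atTop (𝓝 0)) :
    TendstoUniformlyOn Y y atTop (Icc 0 L) := by
  rw [Metric.tendstoUniformlyOn_iff]
  intro ε hε
  filter_upwards [he.eventually_lt_const hε] with n hn x hx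
  rw [dist_comm, Real.dist_eq]
  exact (abs_le_supNorm (hcont n) hx).trans_lt ((hle n).trans_lt hn)

end SupNorm

theorem tendsto_mul_pow_mul {r : ℝ} (hr₀ : 0 ≤ r) (hr : r < 1) (C S : ℝ) :
    Tendsto (fun n : ℕ => C * r ^ n * S) atTop (𝓝 0) := by
  simpa using ((tendsto_pow_atTop_nhds_zero_of_lt_one hr₀ hr).const_mul C).mul_const S

theorem tendsto_mul_pow_div_mul {r : ℝ} (hr₀ : 0 ≤ r) (hr : r < 1) (C S : ℝ) :
    Tendsto (fun n : ℕ => C * (r ^ n / (1 - r)) * S) atTop (𝓝 0) :=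
  (tendsto_mul_pow_mul hr₀ hr C (S / (1 - r))).congr fun n => by ring

/-- The function `u = -y''`, in terms of which the fourth-order problem becomes a second-order
one. -/
noncomputable def curvature (L : ℝ) (y : ℝ → ℝ) (x : ℝ) : ℝ := -D L 2 y x

/-- `y ∈ W^{4,1}[0, L]` with the Navier boundary conditions: the space in which solutions, lower
and upper solutions and iterates live. -/
structure IsNavier (L : ℝ) (y : ℝ → ℝ) : Prop where
  memW41 : MemW41 L y
  navierBC : NavierBC L y

namespace IsNavier

variable {L : ℝ} {y z : ℝ → ℝ}

theorem isDirichlet (hL : 0 < L) (hy : IsNavier L y) : IsDirichlet L y (D L 1 y) (D L 2 y) where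
  primitive := by
    simpa only [D_zero] using isPrimitive_D_of_contDiffOn hL (k := 0) (by norm_num) hy.memW41.1
  primitive' := isPrimitive_D_of_contDiffOn hL (k := 1) (by norm_num) hy.memW41.1
  left := hy.navierBC.1
  right := hy.navierBC.2.1

theorem continuousOn_D_two (hL : 0 < L) (hy : IsNavier L y) :
    ContinuousOn (D L 2 y) (Icc 0 L) :=
  continuousOn_D hL (by norm_num) hy.memW41.1

theorem continuousOn_curvature (hL : 0 < L) (hy : IsNavier L y) :
    ContinuousOn (curvature L y) (Icc 0 L) :=
  (hy.continuousOn_D_two hL).neg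

theorem isDirichlet_curvature (hL : 0 < L) (hy : IsNavier L y) :
    IsDirichlet L (curvature L y) (fun x => -D L 3 y x) (fun x => -D L 4 y x) where
  primitive := (isPrimitive_D_of_contDiffOn hL (k := 2) (by norm_num) hy.memW41.1).neg
  primitive' := (isPrimitive_D hL.le hy.memW41.2).neg
  left := by simp [curvature, hy.navierBC.2.2.1]
  right := by simp [curvature, hy.navierBC.2.2.2]

theorem integral_eq_moment (hL : 0 < L) (hy : IsNavier L y) :
    ∫ x in (0 : ℝ)..L, y x = moment L (curvature L y) :=
  (hy.isDirichlet hL).integral_eq_moment_neg hL.le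

theorem isLinearSolution_curvature (m N : ℝ) (hL : 0 < L) (hy : IsNavier L y) :
    IsLinearSolution L m N (linOp L (m ^ 2) N y) (curvature L y) := by
  refine ⟨_, (hy.isDirichlet_curvature hL).congr_ae (.of_forall fun x => ?_)⟩
  rw [linOp, curvature, hy.integral_eq_moment hL]; ring

theorem below_iff (hL : 0 < L) (hy : IsNavier L y) (hz : IsNavier L z) :
    Below L y z ↔ ∀ x ∈ Icc 0 L, curvature L y x ≤ curvature L z x := by
  refine ⟨fun h x hx => neg_le_neg (h x hx).2, fun h x hx => ⟨?_, neg_le_neg_iff.1 (h x hx)⟩⟩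
  have hcont := (hz.continuousOn_D_two hL).sub (hy.continuousOn_D_two hL)
  exact sub_nonneg.1 <| ((hz.isDirichlet hL).sub (hy.isDirichlet hL)).nonneg hL.le hcont
    (fun t ht => sub_nonpos.2 (neg_le_neg_iff.1 (h t ht))) hx

theorem supNorm_sub_le (hL : 0 < L) (hy : IsNavier L y) (hz : IsNavier L z) :
    supNorm L (fun x => y x - z x) ≤ L ^ 2 / 4 * supNorm L (fun x => D L 2 y x - D L 2 z x) := by
  have hcont := (hy.continuousOn_D_two hL).sub (hz.continuousOn_D_two hL)
  refine supNorm_le hL.le fun x hx => ?_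
  refine (((hy.isDirichlet hL).sub (hz.isDirichlet hL)).abs_le hL.le hcont
    (fun t ht => abs_le_supNorm hcont ht) hx).trans ?_
  rw [mul_comm]
  exact mul_le_mul_of_nonneg_right ((bump_le L x).trans (by nlinarith [sq_nonneg L]))
    (supNorm_nonneg L _)

end IsNavier

theorem supNorm_curvature_sub (L : ℝ) (y z : ℝ → ℝ) :
    supNorm L (fun x => curvature L y x - curvature L z x) =
      supNorm L (fun x => D L 2 y x - D L 2 z x) := by
  simp only [supNorm, curvature, neg_sub_neg, abs_sub_comm]

theorem exists_isDirichlet {L : ℝ} {u : ℝ → ℝ} (hL : 0 < L) (hu : ContinuousOn u (Icc 0 L)) :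
    ∃ y y', IsDirichlet L y y' u := by
  have hP := IsPrimitive.integral hL.le (hu.intervalIntegrable_of_Icc hL.le)
  have hQ := IsPrimitive.integral hL.le (hP.intervalIntegrable hL.le)
  set Q : ℝ → ℝ := fun x => ∫ t in (0 : ℝ)..x, ∫ s in (0 : ℝ)..t, u s with hQdef
  have hline : IsPrimitive 0 L (fun x => Q L / L * x) (fun _ => Q L / L) :=
    .of_hasDerivAt (fun x => by simpa using (hasDerivAt_id x).const_mul (Q L / L)) (by fun_prop)
  have hconst : IsPrimitive 0 L (fun _ => Q L / L) (fun _ => 0) :=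
    .of_hasDerivAt (fun x => hasDerivAt_const x _) continuous_const
  refine ⟨_, _, hQ.sub hline, (hP.sub hconst).congr_ae (.of_forall fun x => sub_zero _), ?_, ?_⟩
  · simp [hQdef]
  · rw [div_mul_cancel₀ _ hL.ne', sub_self]

theorem exists_isNavier_of_isLinearSolution {L m N : ℝ} {u h : ℝ → ℝ} (hL : 0 < L)
    (hu : IsLinearSolution L m N h u) :
    ∃ y, IsNavier L y ∧ EqOn (curvature L y) u (Icc 0 L) ∧
      ∀ᵐ x ∂volume.restrict (Ioo 0 L), linOp L (m ^ 2) N y x = h x := by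
  obtain ⟨y, y', hy⟩ := exists_isDirichlet hL (hu.continuousOn hL.le).neg
  obtain ⟨u', hu⟩ := hu
  obtain ⟨hW, hD2, hD4⟩ := memW41_of_isPrimitive hL hy.1 hy.2 hu.1.neg hu.2.neg
  have hcurv : EqOn (curvature L y) u (Icc 0 L) := fun x hx => by
    rw [curvature, hD2 hx, Pi.neg_apply, neg_neg]
  have hN : IsNavier L y := ⟨hW, hy.3, hy.4, by simp [hD2 (left_mem_Icc.2 hL.le), hu.3],
    by simp [hD2 (right_mem_Icc.2 hL.le), hu.4]⟩
  refine ⟨y, hN, hcurv, ?_⟩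
  filter_upwards [hD4, ae_restrict_mem measurableSet_Ioo] with x hx hxL
  rw [linOp, hx, hD2 (Ioo_subset_Icc_self hxL), hN.integral_eq_moment hL,
    moment_congr hL.le hcurv, Pi.neg_apply]
  ring

theorem ae_restrict_Ioo_of_forall_Icc {a b : ℝ} {P : ℝ → Prop} (h : ∀ x ∈ Icc a b, P x) :
    ∀ᵐ x ∂volume.restrict (Ioo a b), P x :=
  ae_restrict_of_forall_mem measurableSet_Ioo fun x hx => h x (Ioo_subset_Icc_self hx)

theorem abs_moment_le {L δ : ℝ} {u : ℝ → ℝ} (hL : 0 ≤ L) (h : ∀ x ∈ Icc 0 L, |u x| ≤ δ) :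
    |moment L u| ≤ L ^ 3 / 12 * δ := by
  calc |moment L u| ≤ ∫ x in (0 : ℝ)..L, bump L x * δ := by
        have hbound : Continuous fun x => bump L x * δ := by fun_prop
        rw [moment, ← Real.norm_eq_abs]
        refine intervalIntegral.norm_integral_le_of_norm_le hL (.of_forall fun x hx => ?_)
          (hbound.intervalIntegrable 0 L)
        have hx := Ioc_subset_Icc_self hx
        rw [norm_mul, Real.norm_of_nonneg (bump_nonneg hx)]
        exact mul_le_mul_of_nonneg_left (h x hx) (bump_nonneg hx)
    _ = L ^ 3 / 12 * δ := by rw [intervalIntegral.integral_mul_const, integral_bump]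

/-- The right-hand side of the linear problem whose solution is the next iterate after `u`, where
`u` stands for `-y''` and `M = m²`. -/
noncomputable def force (L a b c m N : ℝ) (p u : ℝ → ℝ) (x : ℝ) : ℝ :=
  p x + (m ^ 2 - (a + b * moment L u)) * u x + (N - c) * moment L u

section Force

variable {L a b c m N : ℝ} {p u v : ℝ → ℝ}

theorem force_congr (hL : 0 ≤ L) (h : EqOn u v (Icc 0 L)) :
    EqOn (force L a b c m N p u) (force L a b c m N p v) (Icc 0 L) := fun x hx => by
  rw [force, force, moment_congr hL h, h hx]

theorem intervalIntegrable_force (hL : 0 ≤ L) (hp : IntervalIntegrable p volume 0 L)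
    (hu : ContinuousOn u (Icc 0 L)) :
    IntervalIntegrable (force L a b c m N p u) volume 0 L :=
  (hp.add ((hu.intervalIntegrable_of_Icc hL).const_mul _)).add intervalIntegrable_const

theorem force_sub_force (L a b c m N : ℝ) (p u v : ℝ → ℝ) (x : ℝ) :
    force L a b c m N p u x - force L a b c m N p v x =
      (m ^ 2 - (a + b * moment L u)) * (u x - v x) +
        (N - c - b * v x) * (moment L u - moment L v) := by
  rw [force, force]; ring

end Force

/-- The continuous functions on `[0, L]` lying between `lo` and `hi`. For `lo = -α''` and
`hi = -β''` they are the functions `-y''` with `y` in the sector `[α, β]`. -/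
def band (L : ℝ) (lo hi : ℝ → ℝ) : Set (ℝ → ℝ) :=
  {u | ContinuousOn u (Icc 0 L) ∧ ∀ x ∈ Icc 0 L, lo x ≤ u x ∧ u x ≤ hi x}

section Band

variable {L : ℝ} {lo hi u v : ℝ → ℝ}

theorem supNorm_sub_le_of_mem_band (hL : 0 ≤ L) (hlo : ContinuousOn lo (Icc 0 L))
    (hhi : ContinuousOn hi (Icc 0 L)) (hu : u ∈ band L lo hi) (hv : v ∈ band L lo hi) :
    supNorm L (fun x => u x - v x) ≤ supNorm L (fun x => lo x - hi x) := by
  refine supNorm_le hL fun x hx => le_trans ?_ (abs_le_supNorm (hlo.sub hhi) hx)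
  obtain ⟨hu₁, hu₂⟩ := hu.2 x hx
  obtain ⟨hv₁, hv₂⟩ := hv.2 x hx
  rw [Pi.sub_apply, abs_sub_comm (lo x)]
  exact le_trans (abs_le.2 ⟨by linarith, by linarith⟩) (le_abs_self _)

theorem exists_eqOn_of_contracting_band {K : ℝ} {S : (ℝ → ℝ) → ℝ → ℝ} (hL : 0 ≤ L)
    (hK₀ : 0 ≤ K) (hK : K < 1) (hne : (band L lo hi).Nonempty)
    (hmaps : MapsTo S (band L lo hi) (band L lo hi))
    (hcontr : ∀ u ∈ band L lo hi, ∀ v ∈ band L lo hi,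
      supNorm L (fun x => S u x - S v x) ≤ K * supNorm L (fun x => u x - v x)) :
    ∃ u ∈ band L lo hi, EqOn (S u) u (Icc 0 L) := by
  let E (u : C(Icc (0 : ℝ) L, ℝ)) : ℝ → ℝ := IccExtend hL u
  have hEx (u : C(Icc (0 : ℝ) L, ℝ)) (x : Icc (0 : ℝ) L) : E u x = u x := IccExtend_val hL u x
  let s : Set C(Icc (0 : ℝ) L, ℝ) := {u | ∀ x : Icc (0 : ℝ) L, lo x ≤ u x ∧ u x ≤ hi x}
  have hE {u} (hu : u ∈ s) : E u ∈ band L lo hi :=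
    ⟨u.continuous.Icc_extend'.continuousOn, fun x hx => by rw [hEx u ⟨x, hx⟩]; exact hu ⟨x, hx⟩⟩
  let R (u : ℝ → ℝ) (hu : u ∈ band L lo hi) : s :=
    ⟨⟨(Icc 0 L).domRestrict u, hu.1.domRestrict⟩, fun x => hu.2 x x.2⟩
  have hclosed : IsClosed s := by
    have hset : s = ⋂ x, (fun u : C(Icc (0 : ℝ) L, ℝ) => u x) ⁻¹' Icc (lo x) (hi x) := by
      ext; simp [s]
    rw [hset]
    exact isClosed_iInter fun x => isClosed_Icc.preimage (continuous_eval_const x)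
  let Φ (u : s) : s := R (S (E u)) (hmaps (hE u.2))
  have hΦ : ContractingWith ⟨K, hK₀⟩ Φ := by
    refine ⟨hK, LipschitzWith.of_dist_le_mul fun u v => ?_⟩
    have hdist : supNorm L (fun x => E u x - E v x) ≤ dist u v := supNorm_le hL fun x hx => by
      rw [hEx _ ⟨x, hx⟩, hEx _ ⟨x, hx⟩]
      exact ContinuousMap.dist_apply_le_dist (f := u.1) (g := v.1) ⟨x, hx⟩
    refine (ContinuousMap.dist_le (mul_nonneg hK₀ dist_nonneg)).2 fun x => ?_
    calc |S (E u) x - S (E v) x| ≤ supNorm L (fun x => S (E u) x - S (E v) x) :=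
          abs_le_supNorm ((hmaps (hE u.2)).1.sub (hmaps (hE v.2)).1) x.2
      _ ≤ K * supNorm L (fun x => E u x - E v x) := hcontr _ (hE u.2) _ (hE v.2)
      _ ≤ K * dist u v := mul_le_mul_of_nonneg_left hdist hK₀
  obtain ⟨u₀, hu₀⟩ := hne
  have : CompleteSpace s := hclosed.completeSpace_coe
  obtain ⟨u, hfix, -⟩ := hΦ.exists_fixedPoint (R u₀ hu₀) (edist_ne_top _ _)
  refine ⟨E u, hE u.2, fun x hx => ?_⟩
  rw [hEx _ ⟨x, hx⟩]
  exact congrArg (fun w : s => w.1 ⟨x, hx⟩) hfix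

end Band

/-- The hypotheses of the monotone method, written for `lo = -α''` and `hi = -β''` with
`M = m²`. -/
structure IsBarrier (L a b c m N : ℝ) (p lo hi : ℝ → ℝ) : Prop where
  hL : 0 < L
  hb : 0 ≤ b
  hm : 0 < m
  hN : 0 ≤ N
  hσ : N ≤ 4 * m ^ 2 / L ^ 3 * sigma (m * L)
  integrable : IntervalIntegrable p volume 0 L
  lo_nonneg : ∀ x ∈ Icc 0 L, 0 ≤ lo x
  lo_le_hi : ∀ x ∈ Icc 0 L, lo x ≤ hi x
  le_sq : a + b * moment L hi ≤ m ^ 2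
  add_mul_hi_le : ∀ x ∈ Icc 0 L, c + b * hi x ≤ N
  lower : ∃ h, IsLinearSolution L m N h lo ∧
    ∀ᵐ x ∂volume.restrict (Ioo 0 L), h x ≤ force L a b c m N p lo x
  upper : ∃ h, IsLinearSolution L m N h hi ∧
    ∀ᵐ x ∂volume.restrict (Ioo 0 L), force L a b c m N p hi x ≤ h x

/-- The contraction rate `ρ`, written for `lo = -α''`; the term `b max α''` is absent because
`max α'' = 0`. -/
noncomputable def rate (L a b c m N : ℝ) (lo : ℝ → ℝ) : ℝ :=
  L * (Real.tanh (m * L / 2) / (2 * m)) *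
    (m ^ 2 - (a + b * moment L lo) + L ^ 3 / 4 * (N - c))

/-- A sequence of iterates, written for `-y''`. -/
def IsOrbit (L a b c m N : ℝ) (p : ℝ → ℝ) (U : ℕ → ℝ → ℝ) : Prop :=
  ∀ n, IsLinearSolution L m N (force L a b c m N p (U n)) (U (n + 1))

namespace IsBarrier

variable {L a b c m N : ℝ} {p lo hi u v u' v' : ℝ → ℝ}

theorem lo_mem (B : IsBarrier L a b c m N p lo hi) : lo ∈ band L lo hi :=
  let ⟨_, hlo, _⟩ := B.lower
  ⟨hlo.continuousOn B.hL.le, fun x hx => ⟨le_rfl, B.lo_le_hi x hx⟩⟩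

theorem hi_mem (B : IsBarrier L a b c m N p lo hi) : hi ∈ band L lo hi :=
  let ⟨_, hhi, _⟩ := B.upper
  ⟨hhi.continuousOn B.hL.le, fun x hx => ⟨B.lo_le_hi x hx, le_rfl⟩⟩

theorem supNorm_sub_le (B : IsBarrier L a b c m N p lo hi) (hu : u ∈ band L lo hi)
    (hv : v ∈ band L lo hi) :
    supNorm L (fun x => u x - v x) ≤ supNorm L (fun x => lo x - hi x) :=
  supNorm_sub_le_of_mem_band B.hL.le B.lo_mem.1 B.hi_mem.1 hu hv

theorem mul_moment_le (B : IsBarrier L a b c m N p lo hi) (hu : ContinuousOn u (Icc 0 L))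
    (hv : ContinuousOn v (Icc 0 L)) (huv : ∀ x ∈ Icc 0 L, u x ≤ v x) :
    b * moment L u ≤ b * moment L v :=
  mul_le_mul_of_nonneg_left (moment_mono B.hL.le hu hv huv) B.hb

theorem add_mul_moment_le_sq (B : IsBarrier L a b c m N p lo hi) (hu : u ∈ band L lo hi) :
    a + b * moment L u ≤ m ^ 2 :=
  (add_le_add_right (B.mul_moment_le hu.1 B.hi_mem.1 fun x hx => (hu.2 x hx).2) a).trans B.le_sq

theorem mul_nonneg_of_mem_band (B : IsBarrier L a b c m N p lo hi) (hu : u ∈ band L lo hi)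
    {x : ℝ} (hx : x ∈ Icc 0 L) : 0 ≤ b * u x :=
  mul_nonneg B.hb ((B.lo_nonneg x hx).trans (hu.2 x hx).1)

theorem add_mul_le (B : IsBarrier L a b c m N p lo hi) (hu : u ∈ band L lo hi) {x : ℝ}
    (hx : x ∈ Icc 0 L) : c + b * u x ≤ N :=
  le_trans (by gcongr; exacts [B.hb, (hu.2 x hx).2]) (B.add_mul_hi_le x hx)

theorem c_le_N (B : IsBarrier L a b c m N p lo hi) : c ≤ N := by
  have h0 := left_mem_Icc.2 B.hL.le
  linarith [B.mul_nonneg_of_mem_band B.hi_mem h0, B.add_mul_le B.hi_mem h0]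

theorem lipschitz_force_nonneg (B : IsBarrier L a b c m N p lo hi) :
    0 ≤ m ^ 2 - (a + b * moment L lo) + L ^ 3 / 4 * (N - c) :=
  have hL := B.hL
  add_nonneg (sub_nonneg.2 (B.add_mul_moment_le_sq B.lo_mem))
    (mul_nonneg (by positivity) (sub_nonneg.2 B.c_le_N))

theorem rate_nonneg (B : IsBarrier L a b c m N p lo hi) : 0 ≤ rate L a b c m N lo := by
  have hL := B.hL
  have hm := B.hm
  have htanh : 0 ≤ Real.tanh (m * L / 2) := by
    rw [Real.tanh_eq_sinh_div_cosh]
    exact div_nonneg (Real.sinh_nonneg_iff.2 (by positivity)) (Real.cosh_pos _).le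
  exact mul_nonneg (by positivity) B.lipschitz_force_nonneg

theorem rate_lt_one (B : IsBarrier L a b c m N p lo hi)
    (h : L ^ 3 * N / 4 + m ^ 2 - 4 / L ^ 2 < a + b * moment L lo + L ^ 3 / 4 * c) :
    rate L a b c m N lo < 1 := by
  have hL := B.hL
  have hm := B.hm
  have htanh : L * (Real.tanh (m * L / 2) / (2 * m)) ≤ L ^ 2 / 4 := by
    calc L * (Real.tanh (m * L / 2) / (2 * m)) ≤ L * ((m * L / 2) / (2 * m)) := by
          gcongr; exact tanh_le_self (by positivity)
      _ = L ^ 2 / 4 := by field_simp; ring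
  calc rate L a b c m N lo
      ≤ L ^ 2 / 4 * (m ^ 2 - (a + b * moment L lo) + L ^ 3 / 4 * (N - c)) :=
        mul_le_mul_of_nonneg_right htanh B.lipschitz_force_nonneg
    _ < L ^ 2 / 4 * (4 / L ^ 2) := mul_lt_mul_of_pos_left (by linarith) (by positivity)
    _ = 1 := by field_simp

theorem force_mono (B : IsBarrier L a b c m N p lo hi) (hu : u ∈ band L lo hi)
    (hv : v ∈ band L lo hi) (huv : ∀ x ∈ Icc 0 L, u x ≤ v x) {x : ℝ} (hx : x ∈ Icc 0 L) :
    force L a b c m N p u x ≤ force L a b c m N p v x := by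
  rw [← sub_nonneg, force_sub_force]
  exact add_nonneg
    (mul_nonneg (sub_nonneg.2 (B.add_mul_moment_le_sq hv)) (sub_nonneg.2 (huv x hx)))
    (mul_nonneg (by linarith [B.add_mul_le hu hx])
      (sub_nonneg.2 (moment_mono B.hL.le hu.1 hv.1 huv)))

theorem abs_force_sub_le (B : IsBarrier L a b c m N p lo hi) (hu : u ∈ band L lo hi)
    (hv : v ∈ band L lo hi) {δ : ℝ} (huv : ∀ x ∈ Icc 0 L, |u x - v x| ≤ δ) {x : ℝ}
    (hx : x ∈ Icc 0 L) :
    |force L a b c m N p u x - force L a b c m N p v x| ≤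
      (m ^ 2 - (a + b * moment L lo) + L ^ 3 / 4 * (N - c)) * δ := by
  have hL := B.hL
  have hδ : 0 ≤ δ := (abs_nonneg _).trans (huv x hx)
  have hcoeff : 0 ≤ m ^ 2 - (a + b * moment L u) := sub_nonneg.2 (B.add_mul_moment_le_sq hu)
  have hlo := B.mul_moment_le B.lo_mem.1 hu.1 fun x hx => (hu.2 x hx).1
  have hcoeff' : 0 ≤ N - c - b * v x := by linarith [B.add_mul_le hv hx]
  have hbv := B.mul_nonneg_of_mem_band hv hx
  have hmoment : |moment L u - moment L v| ≤ L ^ 3 / 4 * δ := by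
    rw [← moment_sub hL.le hu.1 hv.1]
    refine (abs_moment_le hL.le huv).trans ?_
    gcongr; norm_num
  rw [force_sub_force]
  calc _ ≤ |(m ^ 2 - (a + b * moment L u)) * (u x - v x)|
          + |(N - c - b * v x) * (moment L u - moment L v)| := abs_add_le _ _
    _ = (m ^ 2 - (a + b * moment L u)) * |u x - v x|
          + (N - c - b * v x) * |moment L u - moment L v| := by
        rw [abs_mul, abs_mul, abs_of_nonneg hcoeff, abs_of_nonneg hcoeff']
    _ ≤ (m ^ 2 - (a + b * moment L lo)) * δ + (N - c) * (L ^ 3 / 4 * δ) := by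
        refine add_le_add (mul_le_mul ?_ (huv x hx) (abs_nonneg _) ?_)
          (mul_le_mul ?_ hmoment (abs_nonneg _) (sub_nonneg.2 B.c_le_N)) <;> linarith
    _ = _ := by ring

theorem step_mono (B : IsBarrier L a b c m N p lo hi) (hu : u ∈ band L lo hi)
    (hv : v ∈ band L lo hi) (hu' : IsLinearSolution L m N (force L a b c m N p u) u')
    (hv' : IsLinearSolution L m N (force L a b c m N p v) v')
    (huv : ∀ x ∈ Icc 0 L, u x ≤ v x) : ∀ x ∈ Icc 0 L, u' x ≤ v' x := fun _ hx =>
  hu'.mono B.hL B.hm B.hN B.hσ hv'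
    (ae_restrict_Ioo_of_forall_Icc fun _ ht => B.force_mono hu hv huv ht) hx

theorem step_mem (B : IsBarrier L a b c m N p lo hi) (hu : u ∈ band L lo hi)
    (hu' : IsLinearSolution L m N (force L a b c m N p u) u') : u' ∈ band L lo hi := by
  obtain ⟨f, hlo, hf⟩ := B.lower
  obtain ⟨g, hhi, hg⟩ := B.upper
  refine ⟨hu'.continuousOn B.hL.le, fun x hx => ⟨?_, ?_⟩⟩
  · refine hlo.mono B.hL B.hm B.hN B.hσ hu' ?_ hx
    filter_upwards [hf, ae_restrict_Ioo_of_forall_Icc fun t ht =>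
      B.force_mono B.lo_mem hu (fun x hx => (hu.2 x hx).1) ht] with t using le_trans
  · refine hu'.mono B.hL B.hm B.hN B.hσ hhi ?_ hx
    filter_upwards [ae_restrict_Ioo_of_forall_Icc fun t ht =>
      B.force_mono hu B.hi_mem (fun x hx => (hu.2 x hx).2) ht, hg] with t using le_trans

theorem supNorm_step_sub_le (B : IsBarrier L a b c m N p lo hi) (hu : u ∈ band L lo hi)
    (hv : v ∈ band L lo hi) (hu' : IsLinearSolution L m N (force L a b c m N p u) u')
    (hv' : IsLinearSolution L m N (force L a b c m N p v) v') :
    supNorm L (fun x => u' x - v' x) ≤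
      rate L a b c m N lo * supNorm L (fun x => u x - v x) := by
  have huv : ∀ x ∈ Icc 0 L, |u x - v x| ≤ supNorm L (fun x => u x - v x) :=
    fun x hx => abs_le_supNorm (hu.1.sub hv.1) hx
  refine supNorm_le B.hL.le fun x hx => ?_
  rw [rate, mul_assoc]
  exact (hu'.sub B.hL.le hv').abs_le B.hL B.hm B.hN B.hσ
    (mul_nonneg B.lipschitz_force_nonneg (supNorm_nonneg L _))
    (ae_restrict_Ioo_of_forall_Icc fun t ht => B.abs_force_sub_le hu hv huv ht) hx

theorem supNorm_sub_eq_zero_of_fixed (B : IsBarrier L a b c m N p lo hi)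
    (hrate : rate L a b c m N lo < 1) (hu : u ∈ band L lo hi) (hv : v ∈ band L lo hi)
    (hu' : IsLinearSolution L m N (force L a b c m N p u) u)
    (hv' : IsLinearSolution L m N (force L a b c m N p v) v) :
    supNorm L (fun x => u x - v x) = 0 := by
  have hstep := B.supNorm_step_sub_le hu hv hu' hv'
  nlinarith [supNorm_nonneg L (fun x => u x - v x)]

theorem exists_fixed (B : IsBarrier L a b c m N p lo hi) (hrate : rate L a b c m N lo < 1) :
    ∃ u ∈ band L lo hi, IsLinearSolution L m N (force L a b c m N p u) u := by
  choose! S hS using fun u (hu : u ∈ band L lo hi) => exists_isLinearSolution B.hL B.hm B.hN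
    (intervalIntegrable_force (a := a) (b := b) (c := c) (m := m) (N := N) B.hL.le B.integrable
      hu.1)
  obtain ⟨u, hu, hfix⟩ := exists_eqOn_of_contracting_band B.hL.le B.rate_nonneg hrate
    ⟨lo, B.lo_mem⟩ (fun u hu => B.step_mem hu (hS u hu))
    fun u hu v hv => B.supNorm_step_sub_le hu hv (hS u hu) (hS v hv)
  exact ⟨S u, B.step_mem hu (hS u hu), (hS u hu).congr_ae
    (ae_restrict_Ioo_of_forall_Icc fun x hx => force_congr B.hL.le hfix.symm hx)⟩

variable {U V : ℕ → ℝ → ℝ}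

theorem orbit_mem (B : IsBarrier L a b c m N p lo hi) (hU : IsOrbit L a b c m N p U)
    (hU0 : U 0 ∈ band L lo hi) (n : ℕ) : U n ∈ band L lo hi := by
  induction n with
  | zero => exact hU0
  | succ n ih => exact B.step_mem ih (hU n)

theorem orbit_le (B : IsBarrier L a b c m N p lo hi) (hU : IsOrbit L a b c m N p U)
    (hV : IsOrbit L a b c m N p V) (hU0 : U 0 ∈ band L lo hi) (hV0 : V 0 ∈ band L lo hi)
    (h : ∀ x ∈ Icc 0 L, U 0 x ≤ V 0 x) (n : ℕ) : ∀ x ∈ Icc 0 L, U n x ≤ V n x := by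
  induction n with
  | zero => exact h
  | succ n ih => exact B.step_mono (B.orbit_mem hU hU0 n) (B.orbit_mem hV hV0 n) (hU n) (hV n) ih

theorem supNorm_orbit_sub_le (B : IsBarrier L a b c m N p lo hi) (hU : IsOrbit L a b c m N p U)
    (hV : IsOrbit L a b c m N p V) (hU0 : U 0 ∈ band L lo hi) (hV0 : V 0 ∈ band L lo hi) (n : ℕ) :
    supNorm L (fun x => U n x - V n x) ≤
      rate L a b c m N lo ^ n * supNorm L (fun x => U 0 x - V 0 x) := by
  induction n with
  | zero => rw [pow_zero, one_mul]
  | succ n ih =>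
    have hstep := B.supNorm_step_sub_le (B.orbit_mem hU hU0 n) (B.orbit_mem hV hV0 n) (hU n) (hV n)
    rw [pow_succ', mul_assoc]
    exact hstep.trans (mul_le_mul_of_nonneg_left ih B.rate_nonneg)

end IsBarrier

section Conversion

variable {L a b c m N : ℝ} {p y α β : ℝ → ℝ}

theorem IsNavier.rhs_eq_force (m N : ℝ) (hL : 0 < L) (hy : IsNavier L y) (x : ℝ) :
    rhs L a b c p y x - m ^ 2 * D L 2 y x + N * ∫ t in (0 : ℝ)..L, y t =
      force L a b c m N p (curvature L y) x := by
  rw [rhs, force, hy.integral_eq_moment hL, curvature]; ring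

theorem IsNavier.linOp_sub_force (a b c m N : ℝ) (p : ℝ → ℝ) (hL : 0 < L) (hy : IsNavier L y)
    (x : ℝ) :
    linOp L (m ^ 2) N y x - force L a b c m N p (curvature L y) x = melanOp L a b c y x - p x := by
  rw [linOp, melanOp, force, hy.integral_eq_moment hL, curvature]; ring

theorem IsSolution.isNavier (hy : IsSolution L a b c p y) : IsNavier L y := ⟨hy.1, hy.2.2⟩

theorem IsLowerSolution.isNavier (hy : IsLowerSolution L a b c p y) : IsNavier L y :=
  ⟨hy.1, hy.2.2⟩

theorem IsUpperSolution.isNavier (hy : IsUpperSolution L a b c p y) : IsNavier L y :=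
  ⟨hy.1, hy.2.2⟩

theorem IsSolution.isLinearSolution_force (m N : ℝ) (hL : 0 < L) (hy : IsSolution L a b c p y) :
    IsLinearSolution L m N (force L a b c m N p (curvature L y)) (curvature L y) := by
  refine (hy.isNavier.isLinearSolution_curvature m N hL).congr_ae ?_
  filter_upwards [hy.2.1] with x hx
  rw [← sub_eq_zero, hy.isNavier.linOp_sub_force a b c m N p hL, hx, sub_self]

theorem exists_isSolution_of_fixed {u : ℝ → ℝ} (hL : 0 < L)
    (hu : IsLinearSolution L m N (force L a b c m N p u) u) :
    ∃ y, IsSolution L a b c p y ∧ EqOn (curvature L y) u (Icc 0 L) := by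
  obtain ⟨y, hy, hyu, hlin⟩ := exists_isNavier_of_isLinearSolution hL hu
  refine ⟨y, ⟨hy.memW41, ?_, hy.navierBC⟩, hyu⟩
  filter_upwards [hlin, ae_restrict_Ioo_of_forall_Icc fun x hx => force_congr hL.le hyu hx]
    with x hx hforce
  rw [← sub_eq_zero, ← hy.linOp_sub_force a b c m N p hL, hx, hforce, sub_self]

theorem mem_sector_iff (hL : 0 < L) (hα : IsNavier L α) (hβ : IsNavier L β) (hy : IsNavier L y) :
    y ∈ sector L α β ↔ curvature L y ∈ band L (curvature L α) (curvature L β) := by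
  rw [sector, mem_ofPred_eq, hα.below_iff hL hy, hy.below_iff hL hβ]
  refine ⟨fun h => ⟨hy.continuousOn_curvature hL, fun x hx => ⟨h.2.1 x hx, h.2.2 x hx⟩⟩,
    fun h => ⟨hy.memW41.1.of_le (by norm_num), fun x hx => (h.2 x hx).1, fun x hx => (h.2 x hx).2⟩⟩

theorem isBarrier_of_lower_upper (hL : 0 < L) (hb : 0 ≤ b) (hm : 0 < m) (hN : 0 ≤ N)
    (hp : IntegrableOn p (Icc 0 L) volume) (hσ : N ≤ 4 * m ^ 2 / L ^ 3 * sigma (m * L))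
    (hα : IsLowerSolution L a b c p α) (hβ : IsUpperSolution L a b c p β)
    (hord : ∀ x ∈ Icc 0 L, D L 2 α x ≤ 0 ∧ D L 2 β x ≤ D L 2 α x)
    (hboundM : a + b * ∫ t in (0 : ℝ)..L, β t ≤ m ^ 2)
    (hboundN : c - b * sInf (D L 2 β '' Icc 0 L) ≤ N) :
    IsBarrier L a b c m N p (curvature L α) (curvature L β) where
  hL := hL
  hb := hb
  hm := hm
  hN := hN
  hσ := hσ
  integrable := (intervalIntegrable_iff_integrableOn_Icc_of_le hL.le).2 hp
  lo_nonneg x hx := neg_nonneg.2 (hord x hx).1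
  lo_le_hi x hx := neg_le_neg (hord x hx).2
  le_sq := by rwa [← hβ.isNavier.integral_eq_moment hL]
  add_mul_hi_le x hx := by
    have hInf : sInf (D L 2 β '' Icc 0 L) ≤ D L 2 β x :=
      csInf_le (isCompact_Icc.bddBelow_image (hβ.isNavier.continuousOn_D_two hL)) ⟨x, hx, rfl⟩
    rw [curvature]
    linarith [mul_le_mul_of_nonneg_left hInf hb]
  lower := by
    refine ⟨_, hα.isNavier.isLinearSolution_curvature m N hL, hα.2.1.mono fun x hx => ?_⟩
    rwa [← sub_nonpos, hα.isNavier.linOp_sub_force a b c m N p hL, sub_nonpos]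
  upper := by
    refine ⟨_, hβ.isNavier.isLinearSolution_curvature m N hL, hβ.2.1.mono fun x hx => ?_⟩
    rwa [← sub_nonneg, hβ.isNavier.linOp_sub_force a b c m N p hL, sub_nonneg]

theorem rho_sq_eq_rate (hL : 0 < L) (hm : 0 < m) (hα : IsNavier L α)
    (hneg : ∀ x ∈ Icc 0 L, D L 2 α x ≤ 0) :
    rho L a b c (m ^ 2) N α = rate L a b c m N (curvature L α) := by
  have hSup : sSup (D L 2 α '' Icc 0 L) = 0 :=
    IsGreatest.csSup_eq ⟨⟨0, left_mem_Icc.2 hL.le, hα.navierBC.2.2.1⟩, forall_mem_image.2 hneg⟩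
  rw [rho, rate, hSup, Real.sqrt_sq hm.le, hα.integral_eq_moment hL, mul_zero, add_zero]

end Conversion

/-- A function `y` satisfying the regularity and boundary conditions of the problem with `-y''` in
the band; the starting points, iterates and solutions to which the estimates apply. -/
structure IsAdmissible (L : ℝ) (lo hi y : ℝ → ℝ) : Prop where
  isNavier : IsNavier L y
  mem_band : curvature L y ∈ band L lo hi

section Iteration

variable {L a b c m M N : ℝ} {p lo hi y y₀ z z₀ : ℝ → ℝ} {Y Z : ℕ → ℝ → ℝ}

theorem IsBarrier.exists_isSolution (B : IsBarrier L a b c m N p lo hi)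
    (hrate : rate L a b c m N lo < 1) : ∃ y, IsSolution L a b c p y ∧ IsAdmissible L lo hi y := by
  obtain ⟨u, hu, hfix⟩ := B.exists_fixed hrate
  obtain ⟨y, hy, hyu⟩ := exists_isSolution_of_fixed B.hL hfix
  exact ⟨y, hy, hy.isNavier, hy.isNavier.continuousOn_curvature B.hL,
    fun x hx => by rw [hyu hx]; exact hu.2 x hx⟩

theorem IsBarrier.eqOn_of_isSolution (B : IsBarrier L a b c m N p lo hi)
    (hrate : rate L a b c m N lo < 1) (hy : IsSolution L a b c p y)
    (hy' : IsAdmissible L lo hi y) (hz : IsSolution L a b c p z) (hz' : IsAdmissible L lo hi z) :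
    EqOn z y (Icc 0 L) := fun x hx => by
  have hzero := B.supNorm_sub_eq_zero_of_fixed hrate hz'.2 hy'.2
    (hz.isLinearSolution_force m N B.hL) (hy.isLinearSolution_force m N B.hL)
  have hle := hz'.1.supNorm_sub_le B.hL hy'.1
  rw [← supNorm_curvature_sub, hzero, mul_zero] at hle
  refine sub_eq_zero.1 (abs_nonpos_iff.1 ((abs_le_supNorm ?_ hx).trans hle))
  exact hz'.1.memW41.1.continuousOn.sub hy'.1.memW41.1.continuousOn

theorem exists_isIteration (hL : 0 < L) (hm : 0 < m) (hN : 0 ≤ N)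
    (hp : IntervalIntegrable p volume 0 L) (hy₀ : IsNavier L y₀) :
    ∃ Y, IsIteration L a b c (m ^ 2) N p y₀ Y := by
  have hstep : ∀ y : {y // IsNavier L y}, ∃ z : {z // IsNavier L z},
      ∀ᵐ x ∂volume.restrict (Ioo 0 L), linOp L (m ^ 2) N z.1 x =
        rhs L a b c p y.1 x - m ^ 2 * D L 2 y.1 x + N * ∫ t in (0 : ℝ)..L, y.1 t := by
    intro ⟨y, hy⟩
    obtain ⟨u, hu⟩ := exists_isLinearSolution hL hm hN (intervalIntegrable_force (a := a) (b := b)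
      (c := c) (m := m) (N := N) hL.le hp (hy.continuousOn_curvature hL))
    obtain ⟨z, hz, -, hlin⟩ := exists_isNavier_of_isLinearSolution hL hu
    exact ⟨⟨z, hz⟩, hlin.mono fun x hx => by rw [hx, hy.rhs_eq_force m N hL]⟩
  choose next hnext using hstep
  exact ⟨fun n => (next^[n] ⟨y₀, hy₀⟩).1, rfl, fun n => by
    simp only [Function.iterate_succ_apply']
    exact ⟨(next _).2.memW41, hnext _, (next _).2.navierBC⟩⟩

namespace IsIteration

theorem tail (hY : IsIteration L a b c M N p y₀ Y) :
    IsIteration L a b c M N p (Y 1) (fun n => Y (n + 1)) :=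
  ⟨rfl, fun n => hY.2 (n + 1)⟩

theorem isNavier (hY : IsIteration L a b c M N p y₀ Y) (hy₀ : IsNavier L y₀) :
    ∀ n, IsNavier L (Y n)
  | 0 => hY.1 ▸ hy₀
  | n + 1 => ⟨(hY.2 n).1, (hY.2 n).2.2⟩

theorem isOrbit (hY : IsIteration L a b c (m ^ 2) N p y₀ Y) (hL : 0 < L) (hy₀ : IsNavier L y₀) :
    IsOrbit L a b c m N p (fun n => curvature L (Y n)) := fun n => by
  refine ((hY.isNavier hy₀ (n + 1)).isLinearSolution_curvature m N hL).congr_ae ?_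
  filter_upwards [(hY.2 n).2.1] with x hx
  rw [hx, (hY.isNavier hy₀ n).rhs_eq_force m N hL]

theorem isAdmissible (hY : IsIteration L a b c (m ^ 2) N p y₀ Y)
    (B : IsBarrier L a b c m N p lo hi) (hy₀ : IsAdmissible L lo hi y₀) (n : ℕ) :
    IsAdmissible L lo hi (Y n) :=
  ⟨hY.isNavier hy₀.1 n,
    B.orbit_mem (hY.isOrbit B.hL hy₀.1) (by simpa only [hY.1] using hy₀.2) n⟩

theorem below (hY : IsIteration L a b c (m ^ 2) N p y₀ Y)
    (hZ : IsIteration L a b c (m ^ 2) N p z₀ Z) (B : IsBarrier L a b c m N p lo hi)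
    (hy₀ : IsAdmissible L lo hi y₀) (hz₀ : IsAdmissible L lo hi z₀)
    (h : ∀ x ∈ Icc 0 L, curvature L y₀ x ≤ curvature L z₀ x) (n : ℕ) : Below L (Y n) (Z n) := by
  rw [(hY.isNavier hy₀.1 n).below_iff B.hL (hZ.isNavier hz₀.1 n)]
  exact B.orbit_le (hY.isOrbit B.hL hy₀.1) (hZ.isOrbit B.hL hz₀.1)
    (hY.isAdmissible B hy₀ 0).2 (hZ.isAdmissible B hz₀ 0).2 (by simpa only [hY.1, hZ.1] using h) n

theorem increment_estimates (hY : IsIteration L a b c (m ^ 2) N p y₀ Y)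
    (B : IsBarrier L a b c m N p lo hi) (hy₀ : IsAdmissible L lo hi y₀) (n : ℕ) :
    supNorm L (fun x => Y (n + 1) x - Y n x) ≤
        L ^ 2 / 4 * supNorm L (fun x => D L 2 (Y (n + 1)) x - D L 2 (Y n) x) ∧
      L ^ 2 / 4 * supNorm L (fun x => D L 2 (Y (n + 1)) x - D L 2 (Y n) x) ≤
        L ^ 2 / 4 * rate L a b c m N lo ^ n *
          supNorm L (fun x => D L 2 (Y 1) x - D L 2 (Y 0) x) ∧
      L ^ 2 / 4 * rate L a b c m N lo ^ n *
          supNorm L (fun x => D L 2 (Y 1) x - D L 2 (Y 0) x) ≤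
        L ^ 2 / 4 * rate L a b c m N lo ^ n * supNorm L (fun x => lo x - hi x) := by
  have hadm := hY.isAdmissible B hy₀
  have horbit := hY.isOrbit B.hL hy₀.1
  refine ⟨(hadm (n + 1)).1.supNorm_sub_le B.hL (hadm n).1, ?_, ?_⟩
  · rw [mul_assoc, ← supNorm_curvature_sub, ← supNorm_curvature_sub]
    exact mul_le_mul_of_nonneg_left (B.supNorm_orbit_sub_le (U := fun n => curvature L (Y (n + 1)))
      (fun n => horbit (n + 1)) horbit (hadm 1).2 (hadm 0).2 n) (by positivity)
  · rw [← supNorm_curvature_sub]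
    exact mul_le_mul_of_nonneg_left (B.supNorm_sub_le (hadm 1).2 (hadm 0).2)
      (mul_nonneg (by positivity) (pow_nonneg B.rate_nonneg n))

theorem error_estimates (hY : IsIteration L a b c (m ^ 2) N p y₀ Y)
    (B : IsBarrier L a b c m N p lo hi) (hrate : rate L a b c m N lo < 1)
    (hy₀ : IsAdmissible L lo hi y₀) (hy : IsSolution L a b c p y)
    (hy' : IsAdmissible L lo hi y) (n : ℕ) :
    supNorm L (fun x => Y n x - y x) ≤
        L ^ 2 / 4 * supNorm L (fun x => D L 2 (Y n) x - D L 2 y x) ∧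
      L ^ 2 / 4 * supNorm L (fun x => D L 2 (Y n) x - D L 2 y x) ≤
        L ^ 2 / 4 * (rate L a b c m N lo ^ n / (1 - rate L a b c m N lo)) *
          supNorm L (fun x => lo x - hi x) := by
  have hadm := hY.isAdmissible B hy₀
  have hpow := pow_nonneg B.rate_nonneg n
  have hpow_le : rate L a b c m N lo ^ n ≤
      rate L a b c m N lo ^ n / (1 - rate L a b c m N lo) :=
    le_div_self hpow (sub_pos.2 hrate) (sub_le_self 1 B.rate_nonneg)
  refine ⟨(hadm n).1.supNorm_sub_le B.hL hy'.1, ?_⟩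
  rw [mul_assoc, ← supNorm_curvature_sub]
  refine mul_le_mul_of_nonneg_left ?_ (by positivity)
  calc supNorm L (fun x => curvature L (Y n) x - curvature L y x)
      ≤ rate L a b c m N lo ^ n * supNorm L (fun x => curvature L (Y 0) x - curvature L y x) :=
        B.supNorm_orbit_sub_le (V := fun _ => curvature L y) (hY.isOrbit B.hL hy₀.1)
          (fun _ => hy.isLinearSolution_force m N B.hL) (hadm 0).2 hy'.2 n
    _ ≤ _ := mul_le_mul hpow_le (B.supNorm_sub_le (hadm 0).2 hy'.2) (supNorm_nonneg L _)
        (hpow.trans hpow_le)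

theorem tendstoUniformlyOn (hY : IsIteration L a b c (m ^ 2) N p y₀ Y)
    (B : IsBarrier L a b c m N p lo hi) (hrate : rate L a b c m N lo < 1)
    (hy₀ : IsAdmissible L lo hi y₀) (hy : IsSolution L a b c p y)
    (hy' : IsAdmissible L lo hi y) : TendstoUniformlyOn Y y atTop (Icc 0 L) :=
  tendstoUniformlyOn_of_supNorm_le
    (fun n => (hY.isNavier hy₀.1 n).memW41.1.continuousOn.sub hy'.1.memW41.1.continuousOn)
    (fun n => have h := hY.error_estimates B hrate hy₀ hy hy' n; h.1.trans h.2)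
    (tendsto_mul_pow_div_mul B.rate_nonneg hrate _ _)

end IsIteration

end Iteration

end Melan

open Melan in
theorem corollary4p1_general
    (L a b c M N : ℝ) (hL : 0 < L) (hb : 0 ≤ b) (hM : 0 < M) (hN : 0 ≤ N)
    (p : ℝ → ℝ) (hp : IntegrableOn p (Icc 0 L) volume)
    (hMN : N ≤ 4 * M / L ^ 3 * sigma (√M * L))
    (α β : ℝ → ℝ)
    (hα : IsLowerSolution L a b c p α) (hβ : IsUpperSolution L a b c p β)
    (hord2 : ∀ x ∈ Icc (0 : ℝ) L, D L 2 α x ≤ 0 ∧ D L 2 β x ≤ D L 2 α x)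
    (hboundM : a + b * ∫ t in (0 : ℝ)..L, β t ≤ M)
    (hboundN : c - b * sInf (D L 2 β '' Icc 0 L) ≤ N)
    (huniq : L ^ 3 * N / 4 + M - 4 / L ^ 2 <
      a + b * (∫ t in (0 : ℝ)..L, α t) + L ^ 3 / 4 * c) :
    0 ≤ rho L a b c M N α ∧ rho L a b c M N α < 1 ∧
    (∃ A, IsIteration L a b c M N p α A) ∧ (∃ B, IsIteration L a b c M N p β B) ∧
    ∃ y : ℝ → ℝ,
      (IsSolution L a b c p y ∧ y ∈ sector L α β ∧
        ∀ z, IsSolution L a b c p z → z ∈ sector L α β → EqOn z y (Icc 0 L)) ∧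
      ∀ A B : ℕ → ℝ → ℝ,
        IsIteration L a b c M N p α A → IsIteration L a b c M N p β B →
        (∀ n, Below L (A n) (A (n + 1)) ∧ Below L (A n) (B n) ∧ Below L (B (n + 1)) (B n)) ∧
        TendstoUniformlyOn A y atTop (Icc 0 L) ∧ TendstoUniformlyOn B y atTop (Icc 0 L) ∧
        (∀ Y, Y = A ∨ Y = B → ∀ n : ℕ,
          (supNorm L (fun x => Y (n + 1) x - Y n x) ≤
              L ^ 2 / 4 * supNorm L (fun x => D L 2 (Y (n + 1)) x - D L 2 (Y n) x) ∧
            L ^ 2 / 4 * supNorm L (fun x => D L 2 (Y (n + 1)) x - D L 2 (Y n) x) ≤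
              L ^ 2 / 4 * rho L a b c M N α ^ n *
                supNorm L (fun x => D L 2 (Y 1) x - D L 2 (Y 0) x) ∧
            L ^ 2 / 4 * rho L a b c M N α ^ n *
                supNorm L (fun x => D L 2 (Y 1) x - D L 2 (Y 0) x) ≤
              L ^ 2 / 4 * rho L a b c M N α ^ n *
                supNorm L (fun x => D L 2 α x - D L 2 β x)) ∧
          (supNorm L (fun x => Y n x - y x) ≤
              L ^ 2 / 4 * supNorm L (fun x => D L 2 (Y n) x - D L 2 y x) ∧
            L ^ 2 / 4 * supNorm L (fun x => D L 2 (Y n) x - D L 2 y x) ≤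
              L ^ 2 / 4 * (rho L a b c M N α ^ n / (1 - rho L a b c M N α)) *
                supNorm L (fun x => D L 2 α x - D L 2 β x))) ∧
        Tendsto (fun n : ℕ => L ^ 2 / 4 * rho L a b c M N α ^ n *
            supNorm L (fun x => D L 2 α x - D L 2 β x)) atTop (𝓝 0) ∧
        Tendsto (fun n : ℕ => L ^ 2 / 4 *
            (rho L a b c M N α ^ n / (1 - rho L a b c M N α)) *
            supNorm L (fun x => D L 2 α x - D L 2 β x)) atTop (𝓝 0) := by
  obtain ⟨m, hm, rfl⟩ : ∃ m, 0 < m ∧ M = m ^ 2 :=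
    ⟨√M, Real.sqrt_pos.2 hM, (Real.sq_sqrt hM.le).symm⟩
  rw [Real.sqrt_sq hm.le] at hMN
  have B := isBarrier_of_lower_upper hL hb hm hN hp hMN hα hβ hord2 hboundM hboundN
  have hαB : IsAdmissible L _ _ α := ⟨hα.isNavier, B.lo_mem⟩
  have hβB : IsAdmissible L _ _ β := ⟨hβ.isNavier, B.hi_mem⟩
  rw [hα.isNavier.integral_eq_moment hL] at huniq
  have hrate := B.rate_lt_one huniq
  rw [rho_sq_eq_rate hL hm hα.isNavier fun x hx => (hord2 x hx).1, ← supNorm_curvature_sub L α β]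
  obtain ⟨y, hy, hyB⟩ := B.exists_isSolution hrate
  refine ⟨B.rate_nonneg, hrate, exists_isIteration hL hm hN B.integrable hα.isNavier,
    exists_isIteration hL hm hN B.integrable hβ.isNavier, y, ⟨hy, ?_, fun z hz hzs => ?_⟩,
    fun A Bs hA hBs => ⟨fun n => ⟨?_, ?_, ?_⟩, hA.tendstoUniformlyOn B hrate hαB hy hyB,
      hBs.tendstoUniformlyOn B hrate hβB hy hyB, ?_,
      tendsto_mul_pow_mul B.rate_nonneg hrate _ _, tendsto_mul_pow_div_mul B.rate_nonneg hrate _ _⟩⟩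
  · exact (mem_sector_iff hL hα.isNavier hβ.isNavier hy.isNavier).2 hyB.2
  · have hzB := (mem_sector_iff hL hα.isNavier hβ.isNavier hz.isNavier).1 hzs
    exact B.eqOn_of_isSolution hrate hy hyB hz ⟨hz.isNavier, hzB⟩
  · have hA1 := hA.isAdmissible B hαB 1
    exact hA.below hA.tail B hαB hA1 (fun x hx => (hA1.2.2 x hx).1) n
  · exact hA.below hBs B hαB hβB B.lo_le_hi n
  · have hB1 := hBs.isAdmissible B hβB 1
    exact hBs.tail.below hBs B hB1 hβB (fun x hx => (hB1.2.2 x hx).2) n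
  · rintro Y (rfl | rfl) n
    exacts [⟨hA.increment_estimates B hαB n, hA.error_estimates B hrate hαB hy hyB n⟩,
      ⟨hBs.increment_estimates B hβB n, hBs.error_estimates B hrate hβB hy hyB n⟩]

open Melan in
theorem corollary4p1
    (L a b c M N : ℝ) (hL : 0 < L) (ha : 0 < a) (hb : 0 < b) (hc : 0 < c)
    (hM : 0 < M) (hN : 0 < N)
    (p : ℝ → ℝ) (hp : IntegrableOn p (Icc 0 L) volume)
    (hMN : N ≤ 4 * M / L ^ 3 * sigma (√M * L))
    (α β : ℝ → ℝ)
    (hα : IsLowerSolution L a b c p α) (hβ : IsUpperSolution L a b c p β)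
    (hord : ∀ x ∈ Icc (0 : ℝ) L, 0 ≤ α x ∧ α x ≤ β x)
    (hord2 : ∀ x ∈ Icc (0 : ℝ) L, D L 2 α x ≤ 0 ∧ D L 2 β x ≤ D L 2 α x)
    (hboundM : a + b * ∫ t in (0 : ℝ)..L, β t ≤ M)
    (hboundN : c - b * sInf (D L 2 β '' Icc 0 L) ≤ N)
    (huniq : L ^ 3 * N / 4 + M - 4 / L ^ 2 <
      a + b * (∫ t in (0 : ℝ)..L, α t) + L ^ 3 / 4 * c) :
    0 ≤ rho L a b c M N α ∧ rho L a b c M N α < 1 ∧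
    -- the iterative sequences started at `α` and at `β` exist
    (∃ A, IsIteration L a b c M N p α A) ∧ (∃ B, IsIteration L a b c M N p β B) ∧
    ∃ y : ℝ → ℝ,
      -- `y` is the unique solution in the sector
      (IsSolution L a b c p y ∧ y ∈ sector L α β ∧
        ∀ z, IsSolution L a b c p z → z ∈ sector L α β → EqOn z y (Icc 0 L)) ∧
      ∀ A B : ℕ → ℝ → ℝ,
        IsIteration L a b c M N p α A → IsIteration L a b c M N p β B →
        -- monotonicity
        (∀ n, Below L (A n) (A (n + 1)) ∧ Below L (A n) (B n) ∧ Below L (B (n + 1)) (B n)) ∧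
        -- uniform convergence
        TendstoUniformlyOn A y atTop (Icc 0 L) ∧ TendstoUniformlyOn B y atTop (Icc 0 L) ∧
        -- estimates for both sequences
        (∀ Y, Y = A ∨ Y = B → ∀ n : ℕ,
          (supNorm L (fun x => Y (n + 1) x - Y n x) ≤
              L ^ 2 / 4 * supNorm L (fun x => D L 2 (Y (n + 1)) x - D L 2 (Y n) x) ∧
            L ^ 2 / 4 * supNorm L (fun x => D L 2 (Y (n + 1)) x - D L 2 (Y n) x) ≤
              L ^ 2 / 4 * rho L a b c M N α ^ n *
                supNorm L (fun x => D L 2 (Y 1) x - D L 2 (Y 0) x) ∧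
            L ^ 2 / 4 * rho L a b c M N α ^ n *
                supNorm L (fun x => D L 2 (Y 1) x - D L 2 (Y 0) x) ≤
              L ^ 2 / 4 * rho L a b c M N α ^ n *
                supNorm L (fun x => D L 2 α x - D L 2 β x)) ∧
          (supNorm L (fun x => Y n x - y x) ≤
              L ^ 2 / 4 * supNorm L (fun x => D L 2 (Y n) x - D L 2 y x) ∧
            L ^ 2 / 4 * supNorm L (fun x => D L 2 (Y n) x - D L 2 y x) ≤
              L ^ 2 / 4 * (rho L a b c M N α ^ n / (1 - rho L a b c M N α)) *
                supNorm L (fun x => D L 2 α x - D L 2 β x))) ∧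
        -- the bounds tend to zero
        Tendsto (fun n : ℕ => L ^ 2 / 4 * rho L a b c M N α ^ n *
            supNorm L (fun x => D L 2 α x - D L 2 β x)) atTop (𝓝 0) ∧
        Tendsto (fun n : ℕ => L ^ 2 / 4 *
            (rho L a b c M N α ^ n / (1 - rho L a b c M N α)) *
            supNorm L (fun x => D L 2 α x - D L 2 β x)) atTop (𝓝 0) :=
  corollary4p1_general L a b c M N hL hb.le hM hN.le p hp hMN α β hα hβ hord2 hboundM hboundN huniq
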